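/- Let $d\ge 2$, let $|x|=\sum_i|x_i|$ on $\mathbb Z^d$, let $E_d=\{\{x,y\}:|x-y|=1\}$ be the set of nearest-neighbour edges, write $x\sim y$ if $\{x,y\}\in E_d$, and let $\Omega=(0,\infty)^{E_d}$. For $\omega\in\Omega$ put $$\mu^\omega(x)=\sum_{y\sim x}\omega(\{x,y\}),\qquad \nu^\omega(x)=\sum_{y\sim x}\frac1{\omega(\{x,y\})},\qquad (\tau_z\omega)(\{x,y\})=\omega(\{x+z,y+z\}).$$ Let $\Omega$ carry a $\sigma$-algebra for which all conductances $\omega\mapsto\omega(e)$ and all shifts $\tau_z$ are measurable. Let $\mathbb P$ be a probability measure on it, with expectation $\mathbb E$, which is stationary: $\mathbb P\circ\tau_z^{-1}=\mathbb P$ for all $z\in\mathbb Z^d$. A function $f:\Omega\to\mathbb R$ is called non-decreasing if $f(\omega)\le f(\omega')$ whenever $\omega(e)\le\omega'(e)$ for all $e\in E_d$. Consider the following conditions on $\mathbb P$ (with all functions $f,g$ measurable). * **(A1)** with parameters $\gamma>d^2$, $C_{\mathrm{mix}}\in(0,\infty)$: (i) for every finite $A\subset E_d$ and all non-decreasing $f,g$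 depending only on $(\omega(e))_{e\in A}$, $\operatorname{Cov}(f,g)\ge0$ whenever the covariance exists; (ii) for every non-decreasing $f\in L^2(\mathbb P)$ depending only on the conductances of the edges at the origin and every $x\ne0$, $\operatorname{Cov}(f,f\circ\tau_x)\le C_{\mathrm{mix}}\|f\|_{L^2(\mathbb P)}^2|x|^{-\gamma}$. * **(A2)** with parameter $C_{\mathrm{sg}}\in(0,\infty)$: for every $f\in L^2(\mathbb P)$ that is a continuously differentiable function of finitely many conductances, $\mathbb E[(f-\mathbb E f)^2]\le C_{\mathrm{sg}}\sum_{e\in E_d}\mathbb E[(\partial_ef)^2]$, where $\partial_ef(\omega)=\limsup_{h\to0}\big(f(\omega+h\delta_e)-f(\omega)\big)/h$. * **(A3)** with parameter $\mathfrak R\in\{1,2,\dots\}$: for every $x\in\mathbb Z^d$ the family $(\omega(\{x,x+e\}):|e|=1)$ is independent of the family $(\omega(\{z,z+e\}):|z-x|\ge\mathfrak R,\ |e|=1)$. * **(A4)** for all disjoint finite $A,B\subset E_d$, all non-decreasing $f$ depending only on $(\omega(e))_{e\in A}$ and all non-decreasing $g$ depending only on $(\omega(e))_{e\in B}$, $\operatorname{Cov}(f,g)\le0$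 whenever the covariance exists. **Proposition.** Let $\zeta,p,q\in[1,\infty)$ and $\gamma\in\mathbb R$. There exist $p_0,q_0,\eta,\theta\in[1,\infty)$ with $\eta-\theta\ge\zeta$, depending only on $d,\zeta,p,q,\gamma$, such that the following holds. Suppose that $\mathbb P$ is stationary and satisfies at least one of: (A1) with rate $\gamma$, where in addition $\zeta<\gamma/d$; (A2); (A3); (A4). (If (A1) is not used, the value of $\gamma$ is irrelevant.) If $\omega(e)\in L^{p_0}(\mathbb P)$ and $\omega(e)^{-1}\in L^{q_0}(\mathbb P)$ for every $e\in E_d$, then $\mathbb E[\mu^\omega(0)^p]$ and $\mathbb E[\nu^\omega(0)^q]$ are finite and there is $c\in(0,\infty)$ such that $$\mathbb E\bigg[\Big|\sum_{x\in R}\big(\mu^\omega(x)^p-\mathbb E[\mu^\omega(0)^p]\big)\Big|^\eta\bigg]\le c\,|R|^\theta,\qquad \mathbb E\bigg[\Big|\sum_{x\in R}\big(\nu^\omega(x)^q-\mathbb E[\nu^\omega(0)^q]\big)\Big|^\eta\bigg]\le c\,|R|^\theta$$ for all hyper-rectangles $R=\prod_{i=1}^d\{a_i,\dots,b_i\}\subset\mathbb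 Z^d$, where $|R|$ is the number of points of $R$. The constant $c$ depends only on $d,\zeta,p,q$, on the parameters $\gamma,C_{\mathrm{mix}},C_{\mathrm{sg}},\mathfrak R$ of the condition that is used, and on an upper bound for $\mathbb E[\mu^\omega(0)^{p_0}]$ and $\mathbb E[\nu^\omega(0)^{q_0}]$. -/

import Mathlib

open MeasureTheory ProbabilityTheory Filter Topology

noncomputable section

namespace RCM

/-- The graph distance to the origin, `|x| = ∑ |x_i|`. -/
def l1 {d : ℕ} (x : Fin d → ℤ) : ℕ := ∑ i, (x i).natAbs

/-- The lattice `(ℤ^d, E_d)`: `x ∼ y` if and only if `|x - y| = 1`. -/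
def lattice (d : ℕ) : SimpleGraph (Fin d → ℤ) where
  Adj x y := l1 (x - y) = 1
  symm := ⟨fun x y h => by
    have e : l1 (y - x) = l1 (x - y) :=
      Finset.sum_congr rfl fun i _ => by simp only [Pi.sub_apply]; omega
    exact e.trans h⟩
  loopless := ⟨fun x h => by simp [l1] at h⟩

instance (d : ℕ) : DecidableRel (lattice d).Adj :=
  fun x y => inferInstanceAs (Decidable (l1 (x - y) = 1))

/-- The set `E_d` of (unoriented) nearest-neighbour edges. -/
abbrev Edge (d : ℕ) : Type := (lattice d).edgeSet

/-- The space of environments `Ω = (0,∞)^{E_d}`. It carries no distinguished σ-algebra. -/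
def Env (d : ℕ) : Type := Edge d → {r : ℝ // 0 < r}

variable {d : ℕ}

/-- The conductance `ω(e)`, as a real number. -/
def weight (ω : Env d) (e : Edge d) : ℝ := (ω e).1

/-- `ω(x,y) = ω({x,y})` if `x ∼ y`, and `0` otherwise. -/
def cond (ω : Env d) (x y : Fin d → ℤ) : ℝ :=
  if h : (lattice d).Adj x y then weight ω ⟨s(x, y), h⟩ else 0

/-- The finite set of neighbours of `x`. -/
def nbrs (x : Fin d → ℤ) : Finset (Fin d → ℤ) :=
  (Finset.Icc (x - 1) (x + 1)).filter fun y => (lattice d).Adj x y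

theorem mem_nbrs (x y : Fin d → ℤ) : y ∈ nbrs x ↔ (lattice d).Adj x y := by
  simp only [nbrs, Finset.mem_filter, Finset.mem_Icc, and_iff_right_iff_imp]
  intro h
  have key : ∀ i, (x i - y i).natAbs ≤ 1 := fun i => by
    have h1 : ∑ i, ((x - y) i).natAbs = 1 := h
    rw [← h1]
    exact Finset.single_le_sum (f := fun i => ((x - y) i).natAbs) (fun _ _ => Nat.zero_le _)
      (Finset.mem_univ i)
  refine ⟨fun i => ?_, fun i => ?_⟩ <;> have := key i <;>
    simp only [Pi.sub_apply, Pi.add_apply, Pi.one_apply] <;> omega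

/-- `μ^ω(x) = ∑_{y ∼ x} ω(x,y)`. -/
def muW (ω : Env d) (x : Fin d → ℤ) : ℝ := ∑ y ∈ nbrs x, cond ω x y

/-- `ν^ω(x) = ∑_{y ∼ x} 1 / ω(x,y)`. -/
def nuW (ω : Env d) (x : Fin d → ℤ) : ℝ := ∑ y ∈ nbrs x, 1 / cond ω x y

/-- Translation of an edge: `{x,y} ↦ {x+z,y+z}`. -/
def shiftEdge (z : Fin d → ℤ) (e : Edge d) : Edge d :=
  ⟨e.1.map (fun x => x + z), by
    obtain ⟨e, he⟩ := e
    induction e with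
    | _ x y =>
      have h : l1 (x - y) = 1 := he
      change l1 (x + z - (y + z)) = 1
      rwa [add_sub_add_right_eq_sub]⟩

/-- The space shift `(τ_z ω)({x,y}) = ω({x+z,y+z})`. -/
def shift (z : Fin d → ℤ) (ω : Env d) : Env d := fun e => ω (shiftEdge z e)

/-- `P` is invariant under all space shifts. -/
def Stationary [MeasurableSpace (Env d)] (P : Measure (Env d)) : Prop :=
  ∀ z : Fin d → ℤ, MeasurePreserving (shift z) P P

/-- `f` is non-decreasing for the coordinatewise order on environments. -/
def NonDecreasing (f : Env d → ℝ) : Prop :=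
  ∀ ω ω' : Env d, (∀ e, weight ω e ≤ weight ω' e) → f ω ≤ f ω'

/-- `f` depends only on the conductances of the edges in `A`. -/
def DependsOnlyOn (f : Env d → ℝ) (A : Set (Edge d)) : Prop :=
  ∀ ω ω' : Env d, (∀ e ∈ A, weight ω e = weight ω' e) → f ω = f ω'

/-- The covariance of `f` and `g` under `P` exists. -/
def CovExists [MeasurableSpace (Env d)] (P : Measure (Env d)) (f g : Env d → ℝ) : Prop :=
  Integrable f P ∧ Integrable g P ∧ Integrable (fun ω => f ω * g ω) P

/-- The FKG inequality. -/
def FKG [MeasurableSpace (Env d)] (P : Measure (Env d)) : Prop :=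
  ∀ (A : Finset (Edge d)) (f g : Env d → ℝ), Measurable f → Measurable g →
    NonDecreasing f → NonDecreasing g → DependsOnlyOn f A → DependsOnlyOn g A →
    CovExists P f g → 0 ≤ covariance f g P

/-- Polynomial mixing with rate `γ` and constant `C`: `Cov(f, f ∘ τ_x) ≤ C ‖f‖²_{L²} |x|^{-γ}`
for `x ≠ 0` and non-decreasing `f ∈ L²` that depend only on the edges at the origin. -/
def PolynomialMixing [MeasurableSpace (Env d)] (P : Measure (Env d)) (γ C : ℝ) : Prop :=
  ∀ f : Env d → ℝ, Measurable f → MemLp f 2 P → NonDecreasing f →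
    DependsOnlyOn f {e | (0 : Fin d → ℤ) ∈ e.1} →
    ∀ x : Fin d → ℤ, x ≠ 0 →
      covariance f (fun ω => f (shift x ω)) P ≤ C * (∫ ω, f ω ^ 2 ∂P) * (l1 x : ℝ) ^ (-γ)

/-- Condition (A1): FKG inequality and polynomial mixing with rate `γ > d²`. -/
def CondA1 [MeasurableSpace (Env d)] (P : Measure (Env d)) (γ C : ℝ) : Prop :=
  (d : ℝ) ^ 2 < γ ∧ 0 < C ∧ FKG P ∧ PolynomialMixing P γ C

open Classical in
/-- `ω + h δ_e`, as long as this is an element of `Ω`, which is so for all small `h`. -/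
def perturb (ω : Env d) (e : Edge d) (h : ℝ) : Env d := fun e' =>
  if H : e' = e ∧ 0 < weight ω e + h then ⟨weight ω e + h, H.2⟩ else ω e'

/-- The vertical derivative `∂_e f(ω) = limsup_{h → 0} (f(ω + h δ_e) - f(ω)) / h`. It is only
used for functions `f` that are differentiable in each conductance. -/
def vertDeriv (e : Edge d) (f : Env d → ℝ) (ω : Env d) : ℝ :=
  limsup (fun h : ℝ => (f (perturb ω e h) - f ω) / h) (𝓝[≠] 0)

/-- `f` is a continuously differentiable function of finitely many conductances. -/
def IsLocalC1 (f : Env d → ℝ) : Prop :=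
  ∃ (A : Finset (Edge d)) (g : (A → ℝ) → ℝ),
    ContDiffOn ℝ 1 g {v | ∀ e, 0 < v e} ∧ ∀ ω, f ω = g fun e => weight ω e

/-- Condition (A2): the spectral gap inequality
`E[(f - E f)²] ≤ C ∑_e E[(∂_e f)²]` with constant `C`, for all `f ∈ L²(P)` that are continuously
differentiable functions of finitely many conductances. (Without a regularity condition on `f` the
inequality fails for every non-deterministic `P`, already for the indicator of `{ω(e) > a}`.) -/
def CondA2 [MeasurableSpace (Env d)] (P : Measure (Env d)) (C : ℝ) : Prop :=
  0 < C ∧ ∀ f : Env d → ℝ, IsLocalC1 f → MemLp f 2 P →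
    ENNReal.ofReal (∫ ω, (f ω - ∫ ω', f ω' ∂P) ^ 2 ∂P) ≤
      ENNReal.ofReal C * ∑' e : Edge d, ∫⁻ ω, ENNReal.ofReal (vertDeriv e f ω ^ 2) ∂P

/-- Condition (A3): finite range dependence with range `𝔯`. -/
def CondA3 [MeasurableSpace (Env d)] (P : Measure (Env d)) (𝔯 : ℕ) : Prop :=
  0 < 𝔯 ∧ ∀ x : Fin d → ℤ,
    IndepFun
      (fun (ω : Env d) (y : {y // (lattice d).Adj x y}) => cond ω x y)
      (fun (ω : Env d) (e : {e : (Fin d → ℤ) × (Fin d → ℤ) //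
        𝔯 ≤ l1 (e.1 - x) ∧ (lattice d).Adj e.1 e.2}) => cond ω e.1.1 e.1.2) P

/-- Condition (A4): negative association. Non-decreasing functions of the conductances on two
disjoint finite sets of edges are non-positively correlated. -/
def CondA4 [MeasurableSpace (Env d)] (P : Measure (Env d)) : Prop :=
  ∀ (A B : Finset (Edge d)) (f g : Env d → ℝ), Disjoint A B → Measurable f → Measurable g →
    NonDecreasing f → NonDecreasing g → DependsOnlyOn f A → DependsOnlyOn g B →
    CovExists P f g → covariance f g P ≤ 0

/-- `Δμ_p^ω(x) = μ^ω(x)^p - E[μ^ω(0)^p]`. -/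
def deltaMu [MeasurableSpace (Env d)] (P : Measure (Env d)) (p : ℝ) (ω : Env d)
    (x : Fin d → ℤ) : ℝ :=
  muW ω x ^ p - ∫ ω', muW ω' 0 ^ p ∂P

/-- `Δν_q^ω(x) = ν^ω(x)^q - E[ν^ω(0)^q]`. -/
def deltaNu [MeasurableSpace (Env d)] (P : Measure (Env d)) (q : ℝ) (ω : Env d)
    (x : Fin d → ℤ) : ℝ :=
  nuW ω x ^ q - ∫ ω', nuW ω' 0 ^ q ∂P

/-- The `(p,q,η,θ)`-moment bound with constant `c`: the means `E[μ^ω(0)^p]`, `E[ν^ω(0)^q]` are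
finite, and for all hyper-rectangles `R = ∏_i {a_i, …, b_i}` in `ℤ^d` the `η`-th absolute moments
of `∑_{x ∈ R} Δμ_p^ω(x)` and of `∑_{x ∈ R} Δν_q^ω(x)` are at most `c |R|^θ`. -/
def MomentBound [MeasurableSpace (Env d)] (P : Measure (Env d)) (p q η θ c : ℝ) : Prop :=
  Integrable (fun ω => muW ω 0 ^ p) P ∧ Integrable (fun ω => nuW ω 0 ^ q) P ∧
  ∀ a b : Fin d → ℤ,
    ∫⁻ ω, ENNReal.ofReal (|∑ x ∈ Finset.Icc a b, deltaMu P p ω x| ^ η) ∂P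
      ≤ ENNReal.ofReal (c * ((Finset.Icc a b).card : ℝ) ^ θ) ∧
    ∫⁻ ω, ENNReal.ofReal (|∑ x ∈ Finset.Icc a b, deltaNu P q ω x| ^ η) ∂P
      ≤ ENNReal.ofReal (c * ((Finset.Icc a b).card : ℝ) ^ θ)

end RCM

end

/-!
Everything is proved for sums over arbitrary finite sets `U` of sites; let `n = |U|`. The two
families `μ^ω(x)` and `ν^ω(x)` are treated together as `A_x = ∑_{y ∼ x} ψ(ω(x,y))` with `ψ(w) = w`
and `ψ(w) = 1 / w`. The moment exponent is `η = 2k` with `k = 2 ^ J` large, and `θ = η - ζ`. Since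
`k` and the integrability exponents are at our disposal, only a saving of `n ^ ζ` over the trivial
bound `n ^ (2k)` is needed.

Under (A1), (A3) and (A4) the variables `A_x ^ p` are truncated at the level `T = n ^ ε`; a high
moment of `A_0` controls the error (`integral_sum_pow_le_of_truncation`). Divided by `T`, the
truncated variables are, up to a sign, non-decreasing and take values in an interval of length
`1`. The sites are coloured by their residues modulo `L`, and Minkowski's inequality reduces the
claim to each colour class (`integral_sum_pow_le_of_colouring`).

* Under (A1) and (A3) the `2k`-th moment is expanded. There are only `O(N ^ k)` products over a
  class of size `N` in which no variable occurs exactly once. In the others one variable is at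
  distance at least `L` from the rest. Under (A1), association bounds the expectation by a sum of
  pair covariances (`abs_integral_mul_prod_le_of_fkg`), hence by `O(L ^ (-γ))`; with
  `L ≈ n ^ ((1 - δ) / d)` this gains `n ^ ((1 - δ) γ / d)`, which is more than `n ^ ζ` for small
  `δ`, and the `O(N ^ k)` remaining products contribute at most `n ^ (2k - δ k)`. Under (A3) the
  expectation vanishes as soon as `L` is the range.
* Under (A4) with `L = 2`, the stars of the sites of a class are disjoint, so the moment
  generating function of the sum is at most the product of those of the summands, and Hoeffding's
  lemma gives a subgaussian bound (`integral_exp_sum_le_of_negativelyAssociated`).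

Under (A2) the spectral gap inequality is applied to the powers `S ^ k`, `k = 1, 2, 4, …`, of the
untruncated sum `S`. It bounds `E[S ^ (2k)]` by `(E[S ^ k]) ^ 2` plus a gradient term, which
Young's inequality splits into a part that is absorbed and a part of order `n ^ k`
(`CondA2.integral_sum_pow_le_sq`).
-/

namespace RCM

/-! ### Moments of sums -/

section Moments

variable {Ω ι : Type*} [MeasurableSpace Ω] {P : Measure Ω}

theorem lpNorm_pow_eq_integral {f : Ω → ℝ} (hf : AEStronglyMeasurable f P) {k : ℕ} (hk : k ≠ 0) :
    lpNorm f ((2 * k : ℕ) : ENNReal) P ^ (2 * k) = ∫ ω, f ω ^ (2 * k) ∂P := by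
  have h2k : (2 * k : ℕ) ≠ 0 := by omega
  rw [lpNorm_eq_integral_norm_rpow_toReal (by exact_mod_cast h2k) (ENNReal.natCast_ne_top _) hf]
  have h0 : (0 : ℝ) ≤ ∫ x, ‖f x‖ ^ (((2 * k : ℕ) : ENNReal).toReal) ∂P :=
    integral_nonneg fun x => by positivity
  rw [ENNReal.toReal_natCast] at h0 ⊢
  rw [Real.rpow_inv_natCast_pow h0 h2k]
  refine integral_congr_ae (ae_of_all _ fun ω => ?_)
  change ‖f ω‖ ^ ((2 * k : ℕ) : ℝ) = f ω ^ (2 * k)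
  rw [Real.rpow_natCast, Real.norm_eq_abs, (even_two_mul k).pow_abs]

theorem lpNorm_le_of_integral_pow_le {f : Ω → ℝ} (hf : AEStronglyMeasurable f P) {k : ℕ}
    (hk : k ≠ 0) {B : ℝ} (hB : 0 ≤ B) (h : ∫ ω, f ω ^ (2 * k) ∂P ≤ B ^ (2 * k)) :
    lpNorm f ((2 * k : ℕ) : ENNReal) P ≤ B := by
  rw [← lpNorm_pow_eq_integral hf hk] at h
  exact le_of_pow_le_pow_left₀ (by omega) hB h

theorem integrable_pow_of_memLp {f : Ω → ℝ} {k : ℕ} (hk : k ≠ 0)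
    (hf : MemLp f ((2 * k : ℕ) : ENNReal) P) : Integrable (fun ω => f ω ^ (2 * k)) P := by
  have := hf.integrable_norm_pow (p := 2 * k) (by omega)
  simpa [Real.norm_eq_abs, (even_two_mul k).pow_abs] using this

/-- Minkowski's inequality over the colour classes `U_c` of a finite set `U`. The diffusive parts
`√|U_c|` are summed by the Cauchy–Schwarz inequality, so the number of colours enters only
through `|C| ^ k`. -/
theorem integral_sum_pow_le_of_colouring {C : Type*} [Fintype C] [DecidableEq C] (col : ι → C)
    (U : Finset ι) (Z : ι → Ω → ℝ) {k : ℕ} (hk : k ≠ 0)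
    (hZ : ∀ x, MemLp (Z x) ((2 * k : ℕ) : ENNReal) P) {a b : ℝ} (ha : 0 ≤ a) (hb : 0 ≤ b)
    (h : ∀ c, ∫ ω, (∑ x ∈ U with col x = c, Z x ω) ^ (2 * k) ∂P
      ≤ a * ((U.filter fun x => col x = c).card : ℝ) ^ (2 * k)
        + b * ((U.filter fun x => col x = c).card : ℝ) ^ k) :
    ∫ ω, (∑ x ∈ U, Z x ω) ^ (2 * k) ∂P
      ≤ 2 ^ (2 * k) * (a * (U.card : ℝ) ^ (2 * k) + b * ((Fintype.card C : ℝ) * U.card) ^ k) := by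
  have h2k : (2 * k : ℕ) ≠ 0 := by omega
  have h1 : (1 : ENNReal) ≤ ((2 * k : ℕ) : ENNReal) := by
    exact_mod_cast (by omega : 1 ≤ 2 * k)
  set N : C → ℝ := fun c => ((U.filter fun x => col x = c).card : ℝ) with hN
  have hN0 : ∀ c, 0 ≤ N c := fun c => by positivity
  have hNsum : ∑ c, N c = U.card := by
    simp only [hN]
    rw [← Nat.cast_sum, ← Finset.card_eq_sum_card_fiberwise (fun _ _ => Finset.mem_coe.2
      (Finset.mem_univ _))]
  set α := a ^ (((2 * k : ℕ) : ℝ)⁻¹) with hα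
  set β := b ^ (((2 * k : ℕ) : ℝ)⁻¹) with hβ
  have hα0 : 0 ≤ α := Real.rpow_nonneg ha _
  have hβ0 : 0 ≤ β := Real.rpow_nonneg hb _
  have hαp : α ^ (2 * k) = a := Real.rpow_inv_natCast_pow ha h2k
  have hβp : β ^ (2 * k) = b := Real.rpow_inv_natCast_pow hb h2k
  have hsqrt : ∀ t : ℝ, 0 ≤ t → (√t) ^ (2 * k) = t ^ k := fun t ht => by
    rw [pow_mul, Real.sq_sqrt ht]
  have hcl : ∀ c, lpNorm (∑ x ∈ U with col x = c, Z x) ((2 * k : ℕ) : ENNReal) P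
      ≤ α * N c + β * √(N c) := fun c => by
    refine lpNorm_le_of_integral_pow_le ?_ hk (by positivity) ?_
    · exact (memLp_finsetSum' _ fun x _ => hZ x).aestronglyMeasurable
    · simp only [Finset.sum_apply]
      refine (h c).trans ?_
      calc a * N c ^ (2 * k) + b * N c ^ k
          = (α * N c) ^ (2 * k) + (β * √(N c)) ^ (2 * k) := by
            rw [mul_pow, mul_pow, hαp, hβp, hsqrt _ (hN0 c)]
        _ ≤ _ := pow_add_pow_le (by positivity) (by positivity) h2k
  have hsum : lpNorm (∑ x ∈ U, Z x) ((2 * k : ℕ) : ENNReal) P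
      ≤ α * U.card + β * √(Fintype.card C * U.card) := by
    have hfib : ∑ x ∈ U, Z x = ∑ c, ∑ x ∈ U with col x = c, Z x :=
      (Finset.sum_fiberwise U col Z).symm
    rw [hfib]
    have hM : ∀ c ∈ (Finset.univ : Finset C),
        MemLp (∑ x ∈ U with col x = c, Z x) ((2 * k : ℕ) : ENNReal) P :=
      fun c _ => memLp_finsetSum' _ fun x _ => hZ x
    refine (lpNorm_sum_le hM h1).trans ?_
    refine (Finset.sum_le_sum fun c _ => hcl c).trans ?_
    rw [Finset.sum_add_distrib, ← Finset.mul_sum, ← Finset.mul_sum, hNsum]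
    gcongr
    refine Real.le_sqrt_of_sq_le ?_
    refine (sq_sum_le_card_mul_sum_sq (s := Finset.univ) (f := fun c => √(N c))).trans ?_
    simp only [Real.sq_sqrt (hN0 _), hNsum, Finset.card_univ, le_refl]
  have hm := lpNorm_pow_eq_integral
    ((memLp_finsetSum' U fun x _ => hZ x).aestronglyMeasurable) hk
  simp only [Finset.sum_apply] at hm
  rw [← hm]
  calc lpNorm (∑ x ∈ U, Z x) ((2 * k : ℕ) : ENNReal) P ^ (2 * k)
      ≤ (α * U.card + β * √(Fintype.card C * U.card)) ^ (2 * k) :=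
        pow_le_pow_left₀ lpNorm_nonneg hsum _
    _ ≤ 2 ^ (2 * k - 1) * ((α * U.card) ^ (2 * k) + (β * √(Fintype.card C * U.card)) ^ (2 * k)) :=
        add_pow_le (by positivity) (by positivity) _
    _ ≤ 2 ^ (2 * k) * ((α * U.card) ^ (2 * k) + (β * √(Fintype.card C * U.card)) ^ (2 * k)) := by
        gcongr
        · norm_num
        · omega
    _ = _ := by
        rw [mul_pow, mul_pow, hαp, hβp, hsqrt _ (by positivity)]

/-- Each value of a map without simple values is taken at least twice, so the map has at most `k`
values. -/
theorem card_filter_not_simple_le [DecidableEq ι] (V : Finset ι) {k : ℕ} (hk : k ≠ 0) :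
    ((Fintype.piFinset fun _ : Fin (2 * k) => V).filter
      fun v => ∀ i, ∃ j, j ≠ i ∧ v j = v i).card ≤ k ^ (2 * k) * V.card ^ k := by
  have hsub : ((Fintype.piFinset fun _ : Fin (2 * k) => V).filter
      fun v => ∀ i, ∃ j, j ≠ i ∧ v j = v i) ⊆
      ((Finset.univ : Finset (Fin (2 * k) → Fin k)) ×ˢ
        (Fintype.piFinset fun _ : Fin k => V)).image fun hg => hg.2 ∘ hg.1 := by
    intro v hv
    rw [Finset.mem_filter, Fintype.mem_piFinset] at hv
    obtain ⟨hvV, hv2⟩ := hv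
    set I := Finset.univ.image v with hI
    have hcard : I.card ≤ k := by
      have h1 := Finset.mul_card_image_le_card (f := v) Finset.univ 2 fun b hb => by
        obtain ⟨i, -, rfl⟩ := Finset.mem_image.1 hb
        obtain ⟨j, hji, hj⟩ := hv2 i
        exact Finset.one_lt_card.2 ⟨i, by simp, j, by simp [hj], hji.symm⟩
      simp only [Finset.card_univ, Fintype.card_fin] at h1
      change 2 * I.card ≤ _ at h1
      omega
    have v0 : Fin (2 * k) := ⟨0, by omega⟩
    let e := I.equivFin
    have hmem : ∀ j, v j ∈ I := fun j => Finset.mem_image_of_mem _ (Finset.mem_univ _)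
    rw [Finset.mem_image]
    refine ⟨(fun j => Fin.castLE hcard (e ⟨v j, hmem j⟩),
      fun i => if h : i.1 < I.card then (e.symm ⟨i.1, h⟩).1 else v v0), ?_, ?_⟩
    · simp only [Finset.mem_product, Finset.mem_univ, true_and, Fintype.mem_piFinset]
      intro i
      split_ifs with h
      · obtain ⟨j, -, hj⟩ := Finset.mem_image.1 (e.symm ⟨i.1, h⟩).2
        rw [← hj]
        exact hvV j
      · exact hvV v0
    · funext j
      simp
  refine (Finset.card_le_card hsub).trans (Finset.card_image_le.trans ?_)
  simp

/-- Expansion of the `2k`-th moment of a sum of variables bounded by `1`: products in which some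
variable occurs exactly once have small expectation by hypothesis, and there are few others. -/
theorem integral_sum_pow_le_of_simple [DecidableEq ι] [IsProbabilityMeasure P] (V : Finset ι)
    (Z : ι → Ω → ℝ) (hZm : ∀ x, Measurable (Z x)) (hZ1 : ∀ x ω, |Z x ω| ≤ 1) {k : ℕ} (hk : k ≠ 0)
    {a : ℝ} (ha : 0 ≤ a)
    (h : ∀ v : Fin (2 * k) → ι, (∀ i, v i ∈ V) → ∀ i, (∀ j, j ≠ i → v j ≠ v i) →
      |∫ ω, ∏ j, Z (v j) ω ∂P| ≤ a) :
    ∫ ω, (∑ x ∈ V, Z x ω) ^ (2 * k) ∂P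
      ≤ a * (V.card : ℝ) ^ (2 * k) + (k : ℝ) ^ (2 * k) * (V.card : ℝ) ^ k := by
  have hprod : ∀ v : Fin (2 * k) → ι, ∀ ω, |∏ j, Z (v j) ω| ≤ 1 := fun v ω => by
    rw [Finset.abs_prod]
    exact Finset.prod_le_one (fun _ _ => abs_nonneg _) fun _ _ => hZ1 _ _
  have hint : ∀ v : Fin (2 * k) → ι, Integrable (fun ω => ∏ j, Z (v j) ω) P := fun v =>
    Integrable.of_bound (Finset.measurable_fun_prod _ fun _ _ => hZm _).aestronglyMeasurable 1
      (ae_of_all _ fun ω => hprod v ω)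
  simp_rw [Finset.sum_pow']
  rw [integral_finsetSum _ fun v _ => hint v,
    ← Finset.sum_filter_add_sum_filter_not _ (fun v => ∀ i, ∃ j, j ≠ i ∧ v j = v i), add_comm]
  refine add_le_add ?_ ?_
  · refine (Finset.sum_le_card_nsmul _ _ a fun v hv => ?_).trans ?_
    · rw [Finset.mem_filter, Fintype.mem_piFinset] at hv
      obtain ⟨hvV, hv2⟩ := hv
      push Not at hv2
      obtain ⟨i, hi⟩ := hv2
      exact (le_abs_self _).trans (h v hvV i hi)
    · rw [nsmul_eq_mul, mul_comm]
      refine mul_le_mul_of_nonneg_left ?_ ha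
      have := Finset.card_filter_le (Fintype.piFinset fun _ : Fin (2 * k) => V)
        (fun v => ¬ ∀ i, ∃ j, j ≠ i ∧ v j = v i)
      rw [Fintype.card_piFinset] at this
      simp only [Finset.prod_const, Finset.card_univ, Fintype.card_fin] at this
      exact_mod_cast this
  · refine (Finset.sum_le_card_nsmul _ _ 1 fun v _ => ?_).trans ?_
    · have h1 := norm_integral_le_of_norm_le_const (μ := P)
        (f := fun ω => ∏ j, Z (v j) ω) (ae_of_all _ fun ω => hprod v ω)
      rw [probReal_univ, mul_one] at h1
      exact (le_abs_self _).trans h1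
    · rw [nsmul_eq_mul, mul_one]
      exact_mod_cast card_filter_not_simple_le V hk

/-- Even moments are bounded by the moment generating function because
`u ^ (2k) / (2k)! ≤ cosh u`. -/
theorem integral_pow_le_of_mgf_le [IsProbabilityMeasure P] {S : Ω → ℝ}
    (hint : ∀ t : ℝ, Integrable (fun ω => Real.exp (t * S ω)) P)
    {n : ℕ} (hn : n ≠ 0) (h : ∀ t : ℝ, ∫ ω, Real.exp (t * S ω) ∂P ≤ Real.exp (n * t ^ 2 / 8))
    (k : ℕ) :
    ∫ ω, S ω ^ (2 * k) ∂P ≤ (2 * k).factorial * Real.exp 1 * (n : ℝ) ^ k := by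
  have hn' : (0 : ℝ) < n := by exact_mod_cast Nat.pos_of_ne_zero hn
  -- the exponent is chosen so that `n * t ^ 2 = 1`
  set t : ℝ := (√n)⁻¹ with ht
  have ht0 : 0 < t := by positivity
  have htn : t ^ 2 * n = 1 := by
    rw [ht, inv_pow, Real.sq_sqrt hn'.le]
    field_simp
  have hbound : ∀ ω, S ω ^ (2 * k) ≤ (2 * k).factorial * (n : ℝ) ^ k *
      ((Real.exp (t * S ω) + Real.exp (-t * S ω)) / 2) := fun ω => by
    have h1 : (t * S ω) ^ (2 * k) / (2 * k).factorial ≤ Real.cosh (t * S ω) := by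
      rw [← (Real.hasSum_cosh (t * S ω)).tsum_eq]
      exact (Real.hasSum_cosh (t * S ω)).summable.le_tsum k fun j _ => by
        rw [pow_mul]; positivity
    rw [Real.cosh_eq, div_le_iff₀ (by positivity)] at h1
    have h2 : S ω ^ (2 * k) = (n : ℝ) ^ k * (t * S ω) ^ (2 * k) := by
      rw [mul_pow, pow_mul t, ← mul_assoc, ← mul_pow, mul_comm (n : ℝ), htn, one_pow, one_mul]
    rw [h2, neg_mul]
    rw [mul_comm _ ((n : ℝ) ^ k), mul_assoc, mul_comm ((2 * k).factorial : ℝ)]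
    exact mul_le_mul_of_nonneg_left h1 (by positivity)
  have he : ∀ s : ℝ, s ^ 2 = t ^ 2 → ∫ ω, Real.exp (s * S ω) ∂P ≤ Real.exp 1 := fun s hs => by
    refine (h s).trans (Real.exp_le_exp.2 ?_)
    rw [hs, mul_comm, htn]
    norm_num
  calc ∫ ω, S ω ^ (2 * k) ∂P
      ≤ ∫ ω, (2 * k).factorial * (n : ℝ) ^ k *
          ((Real.exp (t * S ω) + Real.exp (-t * S ω)) / 2) ∂P := by
        refine integral_mono_of_nonneg (ae_of_all _ fun ω => by
          change 0 ≤ S ω ^ (2 * k); rw [pow_mul]; positivity) ?_ (ae_of_all _ hbound)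
        exact (((hint t).add (hint (-t))).div_const 2).const_mul _
    _ = (2 * k).factorial * (n : ℝ) ^ k *
          ((∫ ω, Real.exp (t * S ω) ∂P + ∫ ω, Real.exp (-t * S ω) ∂P) / 2) := by
        rw [integral_const_mul, integral_div, integral_add (hint t) (hint (-t))]
    _ ≤ (2 * k).factorial * (n : ℝ) ^ k * ((Real.exp 1 + Real.exp 1) / 2) := by
        gcongr
        · exact he t rfl
        · exact he (-t) (neg_sq t)
    _ = _ := by ring

end Moments

/-! ### Truncation -/

section Truncation

variable {Ω ι : Type*} [MeasurableSpace Ω] {P : Measure Ω}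

theorem memLp_of_integrable_pow {f : Ω → ℝ} {k : ℕ} (hk : k ≠ 0) (hf : AEStronglyMeasurable f P)
    (h : Integrable (fun ω => f ω ^ (2 * k)) P) : MemLp f ((2 * k : ℕ) : ENNReal) P := by
  have h2k : (2 * k : ℕ) ≠ 0 := by omega
  rw [← integrable_norm_rpow_iff hf (by exact_mod_cast h2k) (ENNReal.natCast_ne_top _)]
  refine h.congr (ae_of_all _ fun ω => ?_)
  change _ = ‖f ω‖ ^ ((2 * k : ℕ) : ENNReal).toReal
  rw [ENNReal.toReal_natCast, Real.rpow_natCast, Real.norm_eq_abs, (even_two_mul k).pow_abs]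

theorem integrable_of_memLp_two_mul [IsFiniteMeasure P] {f : Ω → ℝ} {k : ℕ} (hk : k ≠ 0)
    (hf : MemLp f ((2 * k : ℕ) : ENNReal) P) : Integrable f P :=
  hf.integrable (by exact_mod_cast (by omega : 1 ≤ 2 * k))

theorem integral_sub_mean_pow_le [IsProbabilityMeasure P] {f : Ω → ℝ} {k : ℕ} (hk : k ≠ 0)
    (hf : MemLp f ((2 * k : ℕ) : ENNReal) P) :
    ∫ ω, (f ω - ∫ ω', f ω' ∂P) ^ (2 * k) ∂P ≤ 2 ^ (2 * k) * ∫ ω, f ω ^ (2 * k) ∂P := by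
  set c := ∫ ω', f ω' ∂P with hc
  have hfi := integrable_pow_of_memLp hk hf
  have hJ : c ^ (2 * k) ≤ ∫ ω, f ω ^ (2 * k) ∂P :=
    ((even_two_mul k).convexOn_pow (𝕜 := ℝ)).map_integral_le (by fun_prop) isClosed_univ
      (ae_of_all _ fun _ => Set.mem_univ _) (integrable_of_memLp_two_mul hk hf) hfi
  calc ∫ ω, (f ω - c) ^ (2 * k) ∂P
      ≤ ∫ ω, 2 ^ (2 * k - 1) * (f ω ^ (2 * k) + c ^ (2 * k)) ∂P := by
        refine integral_mono_of_nonneg (ae_of_all _ fun ω => (even_two_mul k).pow_nonneg _)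
          ((hfi.add (integrable_const _)).const_mul _) (ae_of_all _ fun ω => ?_)
        have := (even_two_mul k).add_pow_le (a := f ω) (b := -c)
        rwa [(even_two_mul k).neg_pow] at this
    _ = 2 ^ (2 * k - 1) * (∫ ω, f ω ^ (2 * k) ∂P + c ^ (2 * k)) := by
        rw [integral_const_mul, integral_add hfi (integrable_const _)]
        simp
    _ ≤ 2 ^ (2 * k - 1) * (∫ ω, f ω ^ (2 * k) ∂P + ∫ ω, f ω ^ (2 * k) ∂P) := by gcongr
    _ = _ := by
        rw [← two_mul, ← mul_assoc, ← pow_succ, show 2 * k - 1 + 1 = 2 * k by omega]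

theorem integral_sum_pow_le_card_pow_mul (U : Finset ι) (f : ι → Ω → ℝ) {k : ℕ} (hk : k ≠ 0)
    (hf : ∀ x, MemLp (f x) ((2 * k : ℕ) : ENNReal) P) {B : ℝ} (hB : 0 ≤ B)
    (h : ∀ x, ∫ ω, f x ω ^ (2 * k) ∂P ≤ B) :
    ∫ ω, (∑ x ∈ U, f x ω) ^ (2 * k) ∂P ≤ (U.card : ℝ) ^ (2 * k) * B := by
  have h2k : (2 * k : ℕ) ≠ 0 := by omega
  have h1 : (1 : ENNReal) ≤ ((2 * k : ℕ) : ENNReal) := by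
    exact_mod_cast (by omega : 1 ≤ 2 * k)
  set β := B ^ (((2 * k : ℕ) : ℝ)⁻¹) with hβ
  have hβ0 : 0 ≤ β := Real.rpow_nonneg hB _
  have hβp : β ^ (2 * k) = B := Real.rpow_inv_natCast_pow hB h2k
  have hs : lpNorm (∑ x ∈ U, f x) ((2 * k : ℕ) : ENNReal) P ≤ U.card * β := by
    refine (lpNorm_sum_le (fun x _ => hf x) h1).trans ?_
    rw [← nsmul_eq_mul]
    exact Finset.sum_le_card_nsmul _ _ _ fun x _ => lpNorm_le_of_integral_pow_le
      (hf x).aestronglyMeasurable hk hβ0 (by rw [hβp]; exact h x)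
  have hm := lpNorm_pow_eq_integral
    ((memLp_finsetSum' U fun x _ => hf x).aestronglyMeasurable) hk
  simp only [Finset.sum_apply] at hm
  rw [← hm, ← hβp, ← mul_pow]
  exact pow_le_pow_left₀ lpNorm_nonneg hs _

/-- Removal of a truncation at level `T`: the excess of `X` over `T` has `2k`-th moment at most
`T ^ (-m) * E[X ^ (2k + m)]`, so that a high moment pays for the trivial bound on the sum of the
excesses. -/
theorem integral_sum_pow_le_of_truncation [IsProbabilityMeasure P] (U : Finset ι) (X : ι → Ω → ℝ)
    (hXm : ∀ x, Measurable (X x)) (hX0 : ∀ x ω, 0 ≤ X x ω) {k : ℕ} (hk : k ≠ 0) {m T B e : ℝ}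
    (hm : 0 < m) (hT : 0 < T) (hXi : ∀ x, Integrable (fun ω => X x ω ^ (2 * k + m)) P)
    (hB : ∀ x, ∫ ω, X x ω ^ (2 * k + m) ∂P ≤ B) (hB0 : 0 ≤ B) (he : ∀ x, ∫ ω, X x ω ∂P = e) :
    ∫ ω, (∑ x ∈ U, (X x ω - e)) ^ (2 * k) ∂P ≤
      2 ^ (2 * k) * (T ^ (2 * k) * ∫ ω, (∑ x ∈ U, (min (X x ω / T) 1
          - ∫ ω', min (X x ω' / T) 1 ∂P)) ^ (2 * k) ∂P
        + (U.card : ℝ) ^ (2 * k) * (2 ^ (2 * k) * (T ^ (-m) * B))) := by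
  set Y : ι → Ω → ℝ := fun x ω => min (X x ω / T) 1 with hY
  have hYm : ∀ x, Measurable (Y x) := fun x => ((hXm x).div_const T).min measurable_const
  have hY0 : ∀ x ω, 0 ≤ Y x ω := fun x ω => le_min (div_nonneg (hX0 x ω) hT.le) zero_le_one
  have hYL : ∀ x, MemLp (Y x) ((2 * k : ℕ) : ENNReal) P := fun x =>
    MemLp.of_bound (hYm x).aestronglyMeasurable 1 (ae_of_all _ fun ω => by
      rw [Real.norm_eq_abs, abs_of_nonneg (hY0 x ω)]; exact min_le_right _ _)
  set D : ι → Ω → ℝ := fun x ω => X x ω - T * Y x ω with hD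
  have hDm : ∀ x, Measurable (D x) := fun x => (hXm x).sub ((hYm x).const_mul T)
  have hDb : ∀ x ω, D x ω ^ (2 * k) ≤ T ^ (-m) * X x ω ^ (2 * k + m) := fun x ω => by
    rcases le_total (X x ω) T with h | h
    · have : D x ω = 0 := by
        simp only [hD, hY]
        rw [min_eq_left ((div_le_one hT).2 h)]
        field_simp
        ring
      rw [this, zero_pow (by omega)]
      exact mul_nonneg (Real.rpow_nonneg hT.le _) (Real.rpow_nonneg (hX0 x ω) _)
    · have hXp : 0 < X x ω := hT.trans_le h
      have h1 : D x ω = X x ω - T := by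
        simp only [hD, hY]
        rw [min_eq_right ((one_le_div hT).2 h), mul_one]
      have h2 : D x ω ^ (2 * k) ≤ X x ω ^ (2 * k) :=
        pow_le_pow_left₀ (by linarith) (by linarith) _
      refine h2.trans ?_
      rw [Real.rpow_add hXp, Real.rpow_neg hT.le, mul_comm (T ^ m)⁻¹, mul_assoc]
      have h3 : (1 : ℝ) ≤ X x ω ^ m * (T ^ m)⁻¹ := by
        rw [← div_eq_mul_inv, one_le_div (Real.rpow_pos_of_pos hT _)]
        exact Real.rpow_le_rpow hT.le h hm.le
      have h4 : X x ω ^ (2 * (k : ℝ)) = X x ω ^ (2 * k) := by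
        rw [← Real.rpow_natCast]; norm_num
      rw [h4]
      exact le_mul_of_one_le_right (by positivity) h3
  have hDi : ∀ x, Integrable (fun ω => D x ω ^ (2 * k)) P := fun x =>
    ((hXi x).const_mul (T ^ (-m))).mono' ((hDm x).pow_const _).aestronglyMeasurable
      (ae_of_all _ fun ω => by
        rw [Real.norm_eq_abs, abs_of_nonneg ((even_two_mul k).pow_nonneg _)]; exact hDb x ω)
  have hDL : ∀ x, MemLp (D x) ((2 * k : ℕ) : ENNReal) P := fun x =>
    memLp_of_integrable_pow hk (hDm x).aestronglyMeasurable (hDi x)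
  have hDB : ∀ x, ∫ ω, D x ω ^ (2 * k) ∂P ≤ T ^ (-m) * B := fun x => by
    refine (integral_mono (hDi x) ((hXi x).const_mul _) (hDb x)).trans ?_
    rw [integral_const_mul]
    exact mul_le_mul_of_nonneg_left (hB x) (Real.rpow_nonneg hT.le _)
  set Z : ι → Ω → ℝ := fun x ω => Y x ω - ∫ ω', Y x ω' ∂P with hZ
  set D' : ι → Ω → ℝ := fun x ω => D x ω - ∫ ω', D x ω' ∂P with hD'
  have hZL : ∀ x, MemLp (Z x) ((2 * k : ℕ) : ENNReal) P := fun x => (hYL x).sub (memLp_const _)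
  have hD'L : ∀ x, MemLp (D' x) ((2 * k : ℕ) : ENNReal) P := fun x => (hDL x).sub (memLp_const _)
  have hsplit : ∀ x ω, X x ω - e = T * Z x ω + D' x ω := fun x ω => by
    have hi := integrable_of_memLp_two_mul hk (hDL x)
    have hj := (integrable_of_memLp_two_mul hk (hYL x)).const_mul T
    have h1 : e = T * ∫ ω', Y x ω' ∂P + ∫ ω', D x ω' ∂P := by
      rw [← integral_const_mul, ← integral_add hj hi, ← he x]
      simp [hD]
    rw [h1]
    simp only [hZ, hD', hD]
    ring
  have hsum : ∀ ω, (∑ x ∈ U, (X x ω - e)) ^ (2 * k) ≤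
      2 ^ (2 * k) * (T ^ (2 * k) * (∑ x ∈ U, Z x ω) ^ (2 * k) + (∑ x ∈ U, D' x ω) ^ (2 * k)) :=
    fun ω => by
      rw [Finset.sum_congr rfl fun x _ => hsplit x ω, Finset.sum_add_distrib, ← Finset.mul_sum,
        ← mul_pow]
      refine ((even_two_mul k).add_pow_le).trans ?_
      refine mul_le_mul_of_nonneg_right (pow_le_pow_right₀ one_le_two (by omega)) ?_
      exact add_nonneg ((even_two_mul k).pow_nonneg _) ((even_two_mul k).pow_nonneg _)
  have hi1 : Integrable (fun ω => (∑ x ∈ U, Z x ω) ^ (2 * k)) P :=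
    integrable_pow_of_memLp hk (memLp_finsetSum U fun x _ => hZL x)
  have hi2 : Integrable (fun ω => (∑ x ∈ U, D' x ω) ^ (2 * k)) P :=
    integrable_pow_of_memLp hk (memLp_finsetSum U fun x _ => hD'L x)
  refine (integral_mono_of_nonneg (ae_of_all _ fun ω => (even_two_mul k).pow_nonneg _)
    (((hi1.const_mul _).add hi2).const_mul _) (ae_of_all _ hsum)).trans ?_
  rw [integral_const_mul]
  refine mul_le_mul_of_nonneg_left ?_ (by positivity)
  refine (integral_add (hi1.const_mul _) hi2).trans_le ?_
  rw [integral_const_mul]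
  refine add_le_add le_rfl ?_
  refine integral_sum_pow_le_card_pow_mul U D' hk hD'L ?_ fun x =>
    (integral_sub_mean_pow_le hk (hDL x)).trans ?_
  · have := Real.rpow_nonneg hT.le (-m)
    positivity
  · exact mul_le_mul_of_nonneg_left (hDB x) (by positivity)

end Truncation

/-! ### Site sums on the lattice -/

section Lattice

variable {d : ℕ}

/-- `∑_{y ∼ x} ψ(ω(x,y))`. The choices `ψ(w) = w` and `ψ(w) = 1 / w` give `μ^ω(x)` and `ν^ω(x)`. -/
noncomputable def siteSum (ψ : ℝ → ℝ) (ω : Env d) (x : Fin d → ℤ) : ℝ :=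
  ∑ y ∈ nbrs x, ψ (cond ω x y)

theorem cond_eq_weight (ω : Env d) {x y : Fin d → ℤ} (h : (lattice d).Adj x y) :
    cond ω x y = weight ω ⟨s(x, y), h⟩ := dif_pos h

theorem cond_pos (ω : Env d) {x y : Fin d → ℤ} (h : (lattice d).Adj x y) : 0 < cond ω x y := by
  rw [cond_eq_weight ω h]
  exact (ω _).2

/-- The finite set of edges with endpoint `x`. -/
noncomputable def edgesAt (x : Fin d → ℤ) : Finset (Edge d) :=
  (nbrs x).attach.image fun y =>
    (⟨s(x, y.1), (SimpleGraph.mem_edgeSet _).2 ((mem_nbrs x y.1).1 y.2)⟩ : Edge d)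

theorem mem_edgesAt {x : Fin d → ℤ} {e : Edge d} : e ∈ edgesAt x ↔ x ∈ e.1 := by
  rw [edgesAt, Finset.mem_image]
  constructor
  · rintro ⟨y, -, rfl⟩
    exact Sym2.mem_mk_left _ _
  · intro h
    obtain ⟨y, hy⟩ := h
    have hadj : (lattice d).Adj x y := by
      have := e.2
      rwa [hy] at this
    exact ⟨⟨y, (mem_nbrs x y).2 hadj⟩, Finset.mem_attach _ _, Subtype.ext hy.symm⟩

theorem card_nbrs_le (x : Fin d → ℤ) : (nbrs x).card ≤ 3 ^ d := by
  refine (Finset.card_filter_le _ _).trans ?_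
  rw [Pi.card_Icc]
  refine (Finset.prod_le_pow_card _ _ 3 fun i _ => ?_).trans ?_
  · rw [Int.card_Icc]
    simp only [Pi.add_apply, Pi.sub_apply, Pi.one_apply]
    omega
  · simp

theorem card_edgesAt_le (x : Fin d → ℤ) : (edgesAt x).card ≤ 3 ^ d := by
  rw [edgesAt]
  refine Finset.card_image_le.trans ?_
  rw [Finset.card_attach]
  exact card_nbrs_le x

theorem disjoint_edgesAt {x y : Fin d → ℤ} (hne : x ≠ y) (h : ¬ (lattice d).Adj x y) :
    Disjoint (edgesAt x) (edgesAt y) := by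
  rw [Finset.disjoint_left]
  intro e hx hy
  rw [mem_edgesAt] at hx hy
  have he := e.2
  rw [(Sym2.mem_and_mem_iff hne).1 ⟨hx, hy⟩] at he
  exact h he

theorem siteSum_nonneg {ψ : ℝ → ℝ} (hψ : ∀ w, 0 < w → 0 < ψ w) (ω : Env d) (x : Fin d → ℤ) :
    0 ≤ siteSum ψ ω x :=
  Finset.sum_nonneg fun y hy => (hψ _ (cond_pos ω ((mem_nbrs x y).1 hy))).le

theorem adj_add_right {x y z : Fin d → ℤ} :
    (lattice d).Adj (x + z) (y + z) ↔ (lattice d).Adj x y := by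
  change l1 (x + z - (y + z)) = 1 ↔ l1 (x - y) = 1
  rw [add_sub_add_right_eq_sub]

theorem cond_shift (z : Fin d → ℤ) (ω : Env d) (x y : Fin d → ℤ) :
    cond (shift z ω) x y = cond ω (x + z) (y + z) := by
  by_cases h : (lattice d).Adj x y
  · rw [cond_eq_weight _ h, cond_eq_weight _ (adj_add_right.2 h)]
    rfl
  · rw [cond, cond, dif_neg h, dif_neg fun h' => h (adj_add_right.1 h')]

theorem siteSum_shift (ψ : ℝ → ℝ) (z : Fin d → ℤ) (ω : Env d) (x : Fin d → ℤ) :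
    siteSum ψ (shift z ω) x = siteSum ψ ω (x + z) := by
  rw [siteSum, siteSum]
  refine Finset.sum_bij (fun y _ => y + z) (fun y hy => ?_) (fun a _ b _ h => add_right_cancel h)
    (fun y hy => ⟨y - z, ?_, sub_add_cancel _ _⟩) fun y _ => by rw [cond_shift]
  · rw [mem_nbrs] at hy ⊢
    exact adj_add_right.2 hy
  · rw [mem_nbrs] at hy ⊢
    rw [← sub_add_cancel y z] at hy
    exact adj_add_right.1 hy

theorem siteSum_eq_of_weight_eq (ψ : ℝ → ℝ) {ω ω' : Env d} {x : Fin d → ℤ}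
    (h : ∀ e ∈ edgesAt x, weight ω e = weight ω' e) : siteSum ψ ω x = siteSum ψ ω' x := by
  refine Finset.sum_congr rfl fun y hy => ?_
  have hadj := (mem_nbrs x y).1 hy
  rw [cond_eq_weight _ hadj, cond_eq_weight _ hadj, h _ (mem_edgesAt.2 (Sym2.mem_mk_left _ _))]

theorem siteSum_le_of_monotoneOn {ψ : ℝ → ℝ} (hψ : MonotoneOn ψ (Set.Ioi 0)) {ω ω' : Env d}
    (h : ∀ e, weight ω e ≤ weight ω' e) (x : Fin d → ℤ) : siteSum ψ ω x ≤ siteSum ψ ω' x := by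
  refine Finset.sum_le_sum fun y hy => ?_
  have hadj := (mem_nbrs x y).1 hy
  refine hψ (cond_pos ω hadj) (cond_pos ω' hadj) ?_
  rw [cond_eq_weight _ hadj, cond_eq_weight _ hadj]
  exact h _

theorem siteSum_le_of_antitoneOn {ψ : ℝ → ℝ} (hψ : AntitoneOn ψ (Set.Ioi 0)) {ω ω' : Env d}
    (h : ∀ e, weight ω e ≤ weight ω' e) (x : Fin d → ℤ) : siteSum ψ ω' x ≤ siteSum ψ ω x := by
  refine Finset.sum_le_sum fun y hy => ?_
  have hadj := (mem_nbrs x y).1 hy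
  refine hψ (cond_pos ω hadj) (cond_pos ω' hadj) ?_
  rw [cond_eq_weight _ hadj, cond_eq_weight _ hadj]
  exact h _

theorem measurable_cond [MeasurableSpace (Env d)]
    (hw : ∀ e : Edge d, Measurable fun ω : Env d => weight ω e) (x y : Fin d → ℤ) :
    Measurable fun ω : Env d => cond ω x y := by
  by_cases h : (lattice d).Adj x y
  · simpa only [cond_eq_weight _ h] using hw _
  · simp only [cond, dif_neg h, measurable_const]

theorem measurable_siteSum [MeasurableSpace (Env d)]
    (hw : ∀ e : Edge d, Measurable fun ω : Env d => weight ω e) {ψ : ℝ → ℝ} (hψ : Measurable ψ)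
    (x : Fin d → ℤ) : Measurable fun ω : Env d => siteSum ψ ω x :=
  Finset.measurable_fun_sum _ fun y _ => hψ.comp (measurable_cond hw x y)

theorem Stationary.integral_siteSum [MeasurableSpace (Env d)] {P : Measure (Env d)}
    (hP : Stationary P) (hw : ∀ e : Edge d, Measurable fun ω : Env d => weight ω e) {ψ : ℝ → ℝ}
    (hψ : Measurable ψ) {F : ℝ → ℝ} (hF : Measurable F) (x : Fin d → ℤ) :
    ∫ ω, F (siteSum ψ ω x) ∂P = ∫ ω, F (siteSum ψ ω 0) ∂P := by
  conv_rhs => rw [← (hP x).map_eq]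
  have hm : Measurable fun ω : Env d => F (siteSum ψ ω 0) := hF.comp (measurable_siteSum hw hψ 0)
  rw [integral_map (hP x).measurable.aemeasurable hm.aestronglyMeasurable]
  simp only [siteSum_shift, zero_add]

theorem Stationary.integrable_siteSum [MeasurableSpace (Env d)] {P : Measure (Env d)}
    (hP : Stationary P) {ψ : ℝ → ℝ} {F : ℝ → ℝ}
    (h : Integrable (fun ω => F (siteSum ψ ω 0)) P) (x : Fin d → ℤ) :
    Integrable (fun ω => F (siteSum ψ ω x)) P := by
  have := (hP x).integrable_comp_of_integrable h
  simpa only [Function.comp_def, siteSum_shift, zero_add] using this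

/-- The residue class of a site modulo `L`. -/
def residue (L : ℕ) (x : Fin d → ℤ) : Fin d → ZMod L := fun i => (x i : ZMod L)

/-- Distinct sites of the same residue class differ by at least `L` in some coordinate. -/
theorem le_l1_sub_of_residue_eq {L : ℕ} {x y : Fin d → ℤ} (h : residue L x = residue L y)
    (hne : x ≠ y) : L ≤ l1 (x - y) := by
  obtain ⟨i, hi⟩ := Function.ne_iff.1 hne
  have h1 : (L : ℤ) ∣ y i - x i := (ZMod.intCast_eq_intCast_iff_dvd_sub _ _ _).1 (congrFun h i)
  have h2 : L ≤ (y i - x i).natAbs :=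
    Nat.le_of_dvd (by omega) (Int.natCast_dvd.1 h1)
  have h3 : ((x - y) i).natAbs ≤ l1 (x - y) :=
    Finset.single_le_sum (f := fun i => ((x - y) i).natAbs) (fun _ _ => Nat.zero_le _)
      (Finset.mem_univ i)
  rw [Pi.sub_apply] at h3
  omega

end Lattice

/-! ### Mixing, finite range and negative association for bounded monotone observables -/

section Observables

variable {d : ℕ} [MeasurableSpace (Env d)] {P : Measure (Env d)}

/-- The centred observable `F(∑_{y ∼ x} ψ(ω(x,y))) - E[F(∑_{y ∼ 0} ψ(ω(0,y)))]` at the site `x`. -/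
noncomputable def centred (P : Measure (Env d)) (ψ F : ℝ → ℝ) (x : Fin d → ℤ) (ω : Env d) : ℝ :=
  F (siteSum ψ ω x) - ∫ ω', F (siteSum ψ ω' 0) ∂P

/-- The observables `F(∑_{y ∼ x} ψ(ω(x,y)))`, `x ∈ ℤ^d`, are non-decreasing in the environment and
take values in one of the intervals `[0,1]` and `[-1,0]`. -/
structure IsMonotoneObservable (d : ℕ) (ψ F : ℝ → ℝ) : Prop where
  measurable_profile : Measurable ψ
  measurable_fun : Measurable F
  monotone : ∀ x : Fin d → ℤ, NonDecreasing fun ω => F (siteSum ψ ω x)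
  abs_le_one : ∀ (ω : Env d) (x : Fin d → ℤ), |F (siteSum ψ ω x)| ≤ 1
  mem_Icc : ∃ c : ℝ, ∀ (ω : Env d) (x : Fin d → ℤ), F (siteSum ψ ω x) ∈ Set.Icc c (c + 1)

variable {ψ F : ℝ → ℝ}

theorem measurable_centred (hF : IsMonotoneObservable d ψ F)
    (hw : ∀ e : Edge d, Measurable fun ω : Env d => weight ω e) (x : Fin d → ℤ) :
    Measurable (centred P ψ F x) :=
  (hF.measurable_fun.comp (measurable_siteSum hw hF.measurable_profile x)).sub measurable_const

theorem integrable_observable [IsProbabilityMeasure P] (hF : IsMonotoneObservable d ψ F)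
    (hw : ∀ e : Edge d, Measurable fun ω : Env d => weight ω e) (x : Fin d → ℤ) :
    Integrable (fun ω => F (siteSum ψ ω x)) P :=
  Integrable.of_bound
    (hF.measurable_fun.comp (measurable_siteSum hw hF.measurable_profile x)).aestronglyMeasurable 1
    (ae_of_all _ fun ω => hF.abs_le_one ω x)

theorem integral_centred [IsProbabilityMeasure P] (hF : IsMonotoneObservable d ψ F)
    (hw : ∀ e : Edge d, Measurable fun ω : Env d => weight ω e) (hP : Stationary P)
    (x : Fin d → ℤ) : ∫ ω, centred P ψ F x ω ∂P = 0 := by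
  simp only [centred]
  rw [integral_sub (integrable_observable hF hw x) (integrable_const _),
    hP.integral_siteSum hw hF.measurable_profile hF.measurable_fun]
  simp

theorem abs_centred_le_one [IsProbabilityMeasure P] (hF : IsMonotoneObservable d ψ F)
    (hw : ∀ e : Edge d, Measurable fun ω : Env d => weight ω e) (x : Fin d → ℤ) (ω : Env d) :
    |centred P ψ F x ω| ≤ 1 := by
  obtain ⟨c, hc⟩ := hF.mem_Icc
  have h1 : c ≤ ∫ ω', F (siteSum ψ ω' 0) ∂P := by
    have := integral_mono (integrable_const c) (integrable_observable (P := P) hF hw 0)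
      fun ω => (hc ω 0).1
    simpa using this
  have h2 : ∫ ω', F (siteSum ψ ω' 0) ∂P ≤ c + 1 := by
    have := integral_mono (integrable_observable (P := P) hF hw 0) (integrable_const (c + 1))
      fun ω => (hc ω 0).2
    simpa using this
  have h3 := hc ω x
  rw [centred, abs_le]
  exact ⟨by linarith [h3.1], by linarith [h3.2]⟩

theorem memLp_centred [IsProbabilityMeasure P] (hF : IsMonotoneObservable d ψ F)
    (hw : ∀ e : Edge d, Measurable fun ω : Env d => weight ω e) (x : Fin d → ℤ) (r : ENNReal) :
    MemLp (centred P ψ F x) r P :=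
  MemLp.of_bound (measurable_centred hF hw x).aestronglyMeasurable 1
    (ae_of_all _ fun ω => abs_centred_le_one hF hw x ω)

theorem nonDecreasing_centred (hF : IsMonotoneObservable d ψ F) (x : Fin d → ℤ) :
    NonDecreasing (centred P ψ F x) := fun ω ω' h => sub_le_sub_right (hF.monotone x ω ω' h) _

theorem centred_eq_of_weight_eq (x : Fin d → ℤ) {ω ω' : Env d}
    (h : ∀ e ∈ edgesAt x, weight ω e = weight ω' e) : centred P ψ F x ω = centred P ψ F x ω' := by
  rw [centred, centred, siteSum_eq_of_weight_eq ψ h]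

theorem centred_shift (x z : Fin d → ℤ) (ω : Env d) :
    centred P ψ F x (shift z ω) = centred P ψ F (x + z) ω := by
  rw [centred, centred, siteSum_shift]

/-- Polynomial mixing, transported from the origin to `x` by stationarity. The `L²` norm of the
observable is at most `1`. -/
theorem covariance_centred_le [IsProbabilityMeasure P] (hF : IsMonotoneObservable d ψ F)
    (hw : ∀ e : Edge d, Measurable fun ω : Env d => weight ω e) (hP : Stationary P) {γ C : ℝ}
    (hC : 0 ≤ C) (hmix : PolynomialMixing P γ C) {x y : Fin d → ℤ} (hne : y ≠ x) :
    covariance (centred P ψ F x) (centred P ψ F y) P ≤ C * (l1 (y - x) : ℝ) ^ (-γ) := by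
  set f : Env d → ℝ := fun ω => F (siteSum ψ ω 0) with hf
  have hfm : Measurable f := hF.measurable_fun.comp (measurable_siteSum hw hF.measurable_profile 0)
  have h1 := hmix f hfm (MemLp.of_bound hfm.aestronglyMeasurable 1
    (ae_of_all _ fun ω => hF.abs_le_one ω 0)) (hF.monotone 0)
    (fun ω ω' h => congrArg F (siteSum_eq_of_weight_eq ψ fun e he => h e (mem_edgesAt.1 he)))
    (y - x) (sub_ne_zero.2 hne)
  have h2 : ∫ ω, f ω ^ 2 ∂P ≤ 1 := by
    have := norm_integral_le_of_norm_le_const (μ := P) (f := fun ω => f ω ^ 2) (C := 1)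
      (ae_of_all _ fun ω => by
        rw [Real.norm_eq_abs, abs_pow]
        exact pow_le_one₀ (abs_nonneg _) (hF.abs_le_one ω 0))
    rw [probReal_univ, mul_one] at this
    exact (le_abs_self _).trans this
  have h3 : covariance (centred P ψ F x) (centred P ψ F y) P
      = covariance f (fun ω => f (shift (y - x) ω)) P := by
    have hx := (hP x).map_eq
    have e1 : covariance (centred P ψ F x) (centred P ψ F y) P
        = covariance (centred P ψ F 0) (centred P ψ F (y - x)) P := by
      have h := covariance_map_fun (μ := P) (Z := shift x) (X := centred P ψ F 0)
        (Y := centred P ψ F (y - x)) (measurable_centred hF hw _).aestronglyMeasurable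
        (measurable_centred hF hw _).aestronglyMeasurable (hP x).measurable.aemeasurable
      rw [hx] at h
      simp only [centred_shift, zero_add, sub_add_cancel] at h
      exact h.symm
    rw [e1]
    have e2 : (fun ω => f (shift (y - x) ω)) = fun ω => F (siteSum ψ ω (y - x)) := by
      funext ω
      simp only [hf, siteSum_shift, zero_add]
    rw [e2]
    exact (covariance_sub_const_left (integrable_observable hF hw 0) _).trans
      (covariance_sub_const_right (integrable_observable hF hw _) _)
  rw [h3]
  refine h1.trans ?_
  refine mul_le_mul_of_nonneg_right ?_ (Real.rpow_nonneg (Nat.cast_nonneg _) _)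
  exact mul_le_of_le_one_right hC h2

theorem abs_prod_sub_prod_le {κ : Type*} (s : Finset κ) (a b : κ → ℝ) (ha : ∀ j, |a j| ≤ 1)
    (hb : ∀ j, |b j| ≤ 1) : |∏ j ∈ s, a j - ∏ j ∈ s, b j| ≤ ∑ j ∈ s, |a j - b j| := by
  classical
  induction s using Finset.induction_on with
  | empty => simp
  | insert i s hi ih =>
    rw [Finset.prod_insert hi, Finset.prod_insert hi, Finset.sum_insert hi]
    have h1 : a i * ∏ j ∈ s, a j - b i * ∏ j ∈ s, b j
        = (a i - b i) * ∏ j ∈ s, a j + b i * (∏ j ∈ s, a j - ∏ j ∈ s, b j) := by ring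
    have h2 : |∏ j ∈ s, a j| ≤ 1 := by
      rw [Finset.abs_prod]
      exact Finset.prod_le_one (fun _ _ => abs_nonneg _) fun j _ => ha j
    rw [h1]
    refine (abs_add_le _ _).trans (add_le_add ?_ ?_)
    · rw [abs_mul]
      exact mul_le_of_le_one_right (abs_nonneg _) h2
    · rw [abs_mul]
      exact (mul_le_of_le_one_left (abs_nonneg _) (hb i)).trans ih

/-- Association bounds the correlation of one observable with a product of others by the sum of
the pair covariances: the product plus or minus the sum of its factors is monotone. -/
theorem abs_integral_mul_prod_le_of_fkg [IsProbabilityMeasure P] (hF : IsMonotoneObservable d ψ F)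
    (hw : ∀ e : Edge d, Measurable fun ω : Env d => weight ω e) (hP : Stationary P)
    (hfkg : FKG P) {κ : Type*} (s : Finset κ) (x : Fin d → ℤ) (v : κ → Fin d → ℤ) :
    |∫ ω, centred P ψ F x ω * ∏ j ∈ s, centred P ψ F (v j) ω ∂P|
      ≤ ∑ j ∈ s, covariance (centred P ψ F x) (centred P ψ F (v j)) P := by
  set W := centred P ψ F with hW
  set G : Env d → ℝ := fun ω => ∏ j ∈ s, W (v j) ω with hG
  set H : Env d → ℝ := fun ω => ∑ j ∈ s, W (v j) ω with hH
  have hWm : ∀ y, Measurable (W y) := measurable_centred hF hw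
  have hW1 : ∀ y ω, |W y ω| ≤ 1 := abs_centred_le_one hF hw
  have hWL : ∀ y, MemLp (W y) 2 P := fun y => memLp_centred hF hw y 2
  have hGm : Measurable G := Finset.measurable_fun_prod _ fun j _ => hWm (v j)
  have hGL : MemLp G 2 P := MemLp.of_bound hGm.aestronglyMeasurable 1 (ae_of_all _ fun ω => by
    rw [Real.norm_eq_abs, hG, Finset.abs_prod]
    exact Finset.prod_le_one (fun _ _ => abs_nonneg _) fun j _ => hW1 _ _)
  have hHm : Measurable H := Finset.measurable_fun_sum _ fun j _ => hWm (v j)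
  have hHL : MemLp H 2 P := memLp_finsetSum s fun j _ => hWL (v j)
  have hdiff : ∀ ω ω' : Env d, (∀ e, weight ω e ≤ weight ω' e) → |G ω' - G ω| ≤ H ω' - H ω :=
    fun ω ω' h => by
      refine (abs_prod_sub_prod_le s _ _ (fun j => hW1 _ _) fun j => hW1 _ _).trans ?_
      rw [hH, ← Finset.sum_sub_distrib]
      refine Finset.sum_le_sum fun j _ => ?_
      rw [abs_of_nonneg (sub_nonneg.2 (nonDecreasing_centred hF _ ω ω' h))]
  set A : Finset (Edge d) := edgesAt x ∪ s.biUnion fun j => edgesAt (v j) with hA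
  have hfx : DependsOnlyOn (W x) A := fun ω ω' h => centred_eq_of_weight_eq x fun e he =>
    h e (Finset.mem_coe.2 (Finset.mem_union_left _ he))
  have hfv : ∀ ω ω' : Env d, (∀ e ∈ (A : Set (Edge d)), weight ω e = weight ω' e) →
      ∀ j ∈ s, W (v j) ω = W (v j) ω' := fun ω ω' h j hj =>
    centred_eq_of_weight_eq (v j) fun e he =>
      h e (Finset.mem_coe.2 (Finset.mem_union_right _ (Finset.mem_biUnion.2 ⟨j, hj, he⟩)))
  have key : ∀ K : Env d → ℝ, Measurable K → MemLp K 2 P → NonDecreasing K →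
      DependsOnlyOn K A → 0 ≤ covariance (W x) K P := fun K hKm hKL hKmono hKdep =>
    hfkg A (W x) K (hWm x) hKm (nonDecreasing_centred hF x) hKmono hfx hKdep
      ⟨(hWL x).integrable one_le_two, hKL.integrable one_le_two, (hWL x).integrable_mul hKL⟩
  have hplus := key (H + G) (hHm.add hGm) (hHL.add hGL)
    (fun ω ω' h => by
      have := (abs_le.1 (hdiff ω ω' h)).1
      simp only [Pi.add_apply]; linarith)
    (fun ω ω' h => by
      simp only [Pi.add_apply, hH, hG]
      rw [Finset.sum_congr rfl (hfv ω ω' h), Finset.prod_congr rfl (hfv ω ω' h)])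
  have hminus := key (H - G) (hHm.sub hGm) (hHL.sub hGL)
    (fun ω ω' h => by
      have := (abs_le.1 (hdiff ω ω' h)).2
      simp only [Pi.sub_apply]; linarith)
    (fun ω ω' h => by
      simp only [Pi.sub_apply, hH, hG]
      rw [Finset.sum_congr rfl (hfv ω ω' h), Finset.prod_congr rfl (hfv ω ω' h)])
  rw [covariance_add_right (hWL x) hHL hGL] at hplus
  rw [covariance_sub_right (hWL x) hHL hGL] at hminus
  have hcG : covariance (W x) G P = ∫ ω, W x ω * G ω ∂P := by
    rw [covariance_eq_sub (hWL x) hGL, integral_centred hF hw hP x, zero_mul, sub_zero]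
    rfl
  have hcH : covariance (W x) H P = ∑ j ∈ s, covariance (W x) (W (v j)) P :=
    covariance_fun_sum_right' (fun j _ => hWL (v j)) (hWL x)
  rw [← hcH, ← hcG, abs_le]
  constructor <;> linarith

/-- The observable at `x` and the product are measurable functions of the two families of
conductances that (A3) declares independent. -/
theorem integral_mul_prod_eq_zero_of_finiteRange [IsProbabilityMeasure P]
    (hF : IsMonotoneObservable d ψ F)
    (hw : ∀ e : Edge d, Measurable fun ω : Env d => weight ω e) (hP : Stationary P) {𝔯 : ℕ}
    (hrange : CondA3 P 𝔯) {κ : Type*} (s : Finset κ) (x : Fin d → ℤ) (v : κ → Fin d → ℤ)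
    (hv : ∀ j ∈ s, 𝔯 ≤ l1 (v j - x)) :
    ∫ ω, centred P ψ F x ω * ∏ j ∈ s, centred P ψ F (v j) ω ∂P = 0 := by
  set m := ∫ ω', F (siteSum ψ ω' 0) ∂P with hm
  set near : ({y // (lattice d).Adj x y} → ℝ) → ℝ := fun u =>
    F (∑ y ∈ (nbrs x).attach, ψ (u ⟨y.1, (mem_nbrs x y.1).1 y.2⟩)) - m with hnear
  set far : ({e : (Fin d → ℤ) × (Fin d → ℤ) // 𝔯 ≤ l1 (e.1 - x) ∧ (lattice d).Adj e.1 e.2} → ℝ)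
      → ℝ := fun u => ∏ j ∈ s.attach, (F (∑ y ∈ (nbrs (v j.1)).attach,
        ψ (u ⟨(v j.1, y.1), hv j.1 j.2, (mem_nbrs _ y.1).1 y.2⟩)) - m) with hfar
  have hnm : Measurable near := (hF.measurable_fun.comp (Finset.measurable_fun_sum _ fun y _ =>
    hF.measurable_profile.comp (measurable_pi_apply _))).sub measurable_const
  have hfm : Measurable far := Finset.measurable_fun_prod _ fun j _ =>
    (hF.measurable_fun.comp (Finset.measurable_fun_sum _ fun y _ =>
      hF.measurable_profile.comp (measurable_pi_apply _))).sub measurable_const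
  have hind := (hrange.2 x).comp hnm hfm
  have e1 : (near ∘ fun (ω : Env d) (y : {y // (lattice d).Adj x y}) => cond ω x y)
      = centred P ψ F x := by
    funext ω
    simp only [hnear, Function.comp_apply, centred, siteSum]
    rw [Finset.sum_attach (nbrs x) fun y => ψ (cond ω x y)]
    rfl
  have e2 : (far ∘ fun (ω : Env d) (e : {e : (Fin d → ℤ) × (Fin d → ℤ) //
        𝔯 ≤ l1 (e.1 - x) ∧ (lattice d).Adj e.1 e.2}) => cond ω e.1.1 e.1.2)
      = fun ω => ∏ j ∈ s, centred P ψ F (v j) ω := by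
    funext ω
    simp only [hfar, Function.comp_apply]
    rw [← Finset.prod_attach s]
    refine Finset.prod_congr rfl fun j _ => ?_
    simp only [centred, siteSum]
    rw [Finset.sum_attach (nbrs (v j.1)) fun y => ψ (cond ω (v j.1) y)]
    rfl
  rw [e1, e2] at hind
  rw [hind.integral_fun_mul_eq_mul_integral (measurable_centred hF hw x).aestronglyMeasurable
    (Finset.measurable_fun_prod _ fun j _ => measurable_centred hF hw (v j)).aestronglyMeasurable,
    integral_centred hF hw hP x, zero_mul]

/-- Negative association makes the moment generating function of a sum over pairwise non-adjacent
sites submultiplicative; Hoeffding's lemma bounds each factor. -/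
theorem integral_exp_sum_le_of_negativelyAssociated [IsProbabilityMeasure P]
    (hF : IsMonotoneObservable d ψ F)
    (hw : ∀ e : Edge d, Measurable fun ω : Env d => weight ω e) (hP : Stationary P)
    (hna : CondA4 P) (V : Finset (Fin d → ℤ))
    (hV : ∀ x ∈ V, ∀ y ∈ V, x ≠ y → ¬ (lattice d).Adj x y) (t : ℝ) :
    Integrable (fun ω => Real.exp (t * ∑ x ∈ V, centred P ψ F x ω)) P ∧
    ∫ ω, Real.exp (t * ∑ x ∈ V, centred P ψ F x ω) ∂P ≤ Real.exp (V.card * t ^ 2 / 8) := by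
  set W := centred P ψ F with hW
  have hWm : ∀ y, Measurable (W y) := measurable_centred hF hw
  have hW1 : ∀ y ω, |W y ω| ≤ 1 := abs_centred_le_one hF hw
  have hSm : ∀ V : Finset (Fin d → ℤ), Measurable fun ω => ∑ x ∈ V, W x ω := fun V =>
    Finset.measurable_fun_sum _ fun y _ => hWm y
  have hEm : ∀ V : Finset (Fin d → ℤ), Measurable fun ω => Real.exp (t * ∑ x ∈ V, W x ω) :=
    fun V => Real.measurable_exp.comp ((hSm V).const_mul t)
  have hEL : ∀ V : Finset (Fin d → ℤ), MemLp (fun ω => Real.exp (t * ∑ x ∈ V, W x ω)) 2 P :=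
    fun V => MemLp.of_bound (hEm V).aestronglyMeasurable (Real.exp (|t| * V.card))
      (ae_of_all _ fun ω => by
        rw [Real.norm_eq_abs, Real.abs_exp, Real.exp_le_exp]
        refine (le_abs_self _).trans ?_
        rw [abs_mul]
        refine mul_le_mul_of_nonneg_left ?_ (abs_nonneg _)
        refine (Finset.abs_sum_le_sum_abs _ _).trans ?_
        simpa using Finset.sum_le_card_nsmul V _ 1 fun x _ => hW1 x ω)
  have hmono : ∀ V : Finset (Fin d → ℤ), NonDecreasing fun ω => ∑ x ∈ V, W x ω := fun V ω ω' h =>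
    Finset.sum_le_sum fun x _ => nonDecreasing_centred hF x ω ω' h
  have hdep : ∀ V : Finset (Fin d → ℤ),
      DependsOnlyOn (fun ω => ∑ x ∈ V, W x ω) (V.biUnion edgesAt : Finset (Edge d)) :=
    fun V ω ω' h => Finset.sum_congr rfl fun x hx => centred_eq_of_weight_eq x fun e he =>
      h e (Finset.mem_coe.2 (Finset.mem_biUnion.2 ⟨x, hx, he⟩))
  refine ⟨(hEL V).integrable one_le_two, ?_⟩
  have hone : ∀ x, ∫ ω, Real.exp (t * W x ω) ∂P ≤ Real.exp (t ^ 2 / 8) := fun x => by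
    obtain ⟨c, hc⟩ := hF.mem_Icc
    have h1 := (hasSubgaussianMGF_of_mem_Icc (μ := P) (X := fun ω => F (siteSum ψ ω x))
      (hF.measurable_fun.comp (measurable_siteSum hw hF.measurable_profile x)).aemeasurable
      (ae_of_all _ fun ω => hc ω x)).mgf_le t
    rw [hP.integral_siteSum hw hF.measurable_profile hF.measurable_fun] at h1
    refine h1.trans (Real.exp_le_exp.2 (le_of_eq ?_))
    simp only [add_sub_cancel_left, nnnorm_one]
    push_cast
    ring
  induction V using Finset.induction_on with
  | empty => simp
  | insert x V hx ih =>
    have ih' := ih fun a ha b hb => hV a (Finset.mem_insert_of_mem ha) b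
      (Finset.mem_insert_of_mem hb)
    have hdisj : Disjoint (({x} : Finset (Fin d → ℤ)).biUnion edgesAt) (V.biUnion edgesAt) := by
      rw [Finset.singleton_biUnion, Finset.disjoint_biUnion_right]
      intro y hy
      have hxy : x ≠ y := fun h => hx (h ▸ hy)
      exact disjoint_edgesAt hxy (hV x (Finset.mem_insert_self _ _) y
        (Finset.mem_insert_of_mem hy) hxy)
    have hcov : covariance (fun ω => Real.exp (t * ∑ y ∈ {x}, W y ω))
        (fun ω => Real.exp (t * ∑ y ∈ V, W y ω)) P ≤ 0 := by
      have hex : ∀ V₁ V₂ : Finset (Fin d → ℤ), Integrable (fun ω =>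
          Real.exp (t * ∑ y ∈ V₁, W y ω) * Real.exp (t * ∑ y ∈ V₂, W y ω)) P := fun V₁ V₂ =>
        (hEL V₁).integrable_mul (hEL V₂)
      rcases le_total 0 t with ht | ht
      · refine hna _ _ _ _ hdisj (hEm _) (hEm _) (fun ω ω' h => ?_) (fun ω ω' h => ?_)
          (fun ω ω' h => ?_) (fun ω ω' h => ?_) ⟨(hEL _).integrable one_le_two,
            (hEL _).integrable one_le_two, hex _ _⟩
        · exact Real.exp_le_exp.2 (mul_le_mul_of_nonneg_left (hmono _ ω ω' h) ht)
        · exact Real.exp_le_exp.2 (mul_le_mul_of_nonneg_left (hmono _ ω ω' h) ht)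
        · exact congrArg (fun u => Real.exp (t * u)) (hdep {x} ω ω' h)
        · exact congrArg (fun u => Real.exp (t * u)) (hdep V ω ω' h)
      · -- for negative `t` both exponentials are non-increasing; the signs cancel
        have := hna _ _ (fun ω => -Real.exp (t * ∑ y ∈ {x}, W y ω))
          (fun ω => -Real.exp (t * ∑ y ∈ V, W y ω)) hdisj (hEm _).neg (hEm _).neg
          (fun ω ω' h => neg_le_neg
            (Real.exp_le_exp.2 (mul_le_mul_of_nonpos_left (hmono _ ω ω' h) ht)))
          (fun ω ω' h => neg_le_neg
            (Real.exp_le_exp.2 (mul_le_mul_of_nonpos_left (hmono _ ω ω' h) ht)))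
          (fun ω ω' h => congrArg (fun u => -Real.exp (t * u)) (hdep {x} ω ω' h))
          (fun ω ω' h => congrArg (fun u => -Real.exp (t * u)) (hdep V ω ω' h))
          ⟨((hEL _).integrable one_le_two).neg, ((hEL _).integrable one_le_two).neg, by
            simpa only [neg_mul_neg] using hex {x} V⟩
        rwa [covariance_fun_neg_left, covariance_fun_neg_right, neg_neg] at this
    rw [covariance_eq_sub (hEL _) (hEL _)] at hcov
    have hsplit : ∫ ω, Real.exp (t * ∑ y ∈ insert x V, W y ω) ∂P
        = ∫ ω, ((fun ω => Real.exp (t * ∑ y ∈ {x}, W y ω)) *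
          fun ω => Real.exp (t * ∑ y ∈ V, W y ω)) ω ∂P := by
      refine integral_congr_ae (ae_of_all _ fun ω => ?_)
      simp only [Pi.mul_apply]
      rw [Finset.sum_insert hx, mul_add, Real.exp_add, Finset.sum_singleton]
    rw [hsplit]
    refine (sub_nonpos.1 hcov).trans ?_
    simp only [Finset.sum_singleton]
    rw [Finset.card_insert_of_notMem hx]
    calc _ ≤ Real.exp (t ^ 2 / 8) * Real.exp (V.card * t ^ 2 / 8) :=
          mul_le_mul (hone x) ih' (integral_nonneg fun ω => (Real.exp_pos _).le)
            (Real.exp_pos _).le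
      _ = _ := by
          rw [← Real.exp_add]
          congr 1
          push_cast
          ring

end Observables

/-! ### Moment bounds for sums of bounded monotone observables -/

section ObservableMoments

variable {d : ℕ} [MeasurableSpace (Env d)] {P : Measure (Env d)} {ψ F : ℝ → ℝ}

theorem card_residue_classes (d L : ℕ) [NeZero L] :
    (Fintype.card (Fin d → ZMod L) : ℝ) = (L : ℝ) ^ d := by
  rw [Fintype.card_fun, ZMod.card, Fintype.card_fin]
  push_cast
  rfl

/-- Colouring the sites by their residues modulo `L`, a bound on the correlation of one observable
with a product of others at distance at least `L` gives a moment bound. -/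
theorem integral_sum_centred_pow_le_of_correlation [IsProbabilityMeasure P]
    (hF : IsMonotoneObservable d ψ F)
    (hw : ∀ e : Edge d, Measurable fun ω : Env d => weight ω e)
    (U : Finset (Fin d → ℤ)) {k : ℕ} (hk : k ≠ 0) {L : ℕ} (hL : L ≠ 0) {a : ℝ} (ha : 0 ≤ a)
    (h : ∀ (s : Finset (Fin (2 * k))) (x : Fin d → ℤ) (v : Fin (2 * k) → Fin d → ℤ),
      (∀ j ∈ s, v j ≠ x ∧ L ≤ l1 (v j - x)) →
      |∫ ω, centred P ψ F x ω * ∏ j ∈ s, centred P ψ F (v j) ω ∂P| ≤ a) :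
    ∫ ω, (∑ x ∈ U, centred P ψ F x ω) ^ (2 * k) ∂P ≤
      2 ^ (2 * k) * (a * (U.card : ℝ) ^ (2 * k)
        + (k : ℝ) ^ (2 * k) * ((L : ℝ) ^ d * U.card) ^ k) := by
  have : NeZero L := ⟨hL⟩
  rw [← card_residue_classes d L]
  refine integral_sum_pow_le_of_colouring (residue L) U _ hk
    (fun x => memLp_centred hF hw x _) ha (by positivity) fun c => ?_
  refine integral_sum_pow_le_of_simple _ _ (measurable_centred hF hw) (abs_centred_le_one hF hw)
    hk ha fun v hv i hi => ?_
  have hres : ∀ j, residue L (v j) = c := fun j => (Finset.mem_filter.1 (hv j)).2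
  simp_rw [← Finset.mul_prod_erase Finset.univ _ (Finset.mem_univ i)]
  refine h _ _ _ fun j hj => ?_
  have hne := hi j (Finset.ne_of_mem_erase hj)
  exact ⟨hne, le_l1_sub_of_residue_eq ((hres j).trans (hres i).symm) hne⟩

theorem CondA1.integral_sum_centred_pow_le [IsProbabilityMeasure P]
    (hF : IsMonotoneObservable d ψ F)
    (hw : ∀ e : Edge d, Measurable fun ω : Env d => weight ω e) (hP : Stationary P) {γ C : ℝ}
    (h : CondA1 P γ C) (U : Finset (Fin d → ℤ)) {k : ℕ} (hk : k ≠ 0) {L : ℕ} (hL : L ≠ 0) :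
    ∫ ω, (∑ x ∈ U, centred P ψ F x ω) ^ (2 * k) ∂P ≤
      2 ^ (2 * k) * (2 * k * C * (L : ℝ) ^ (-γ) * (U.card : ℝ) ^ (2 * k)
        + (k : ℝ) ^ (2 * k) * ((L : ℝ) ^ d * U.card) ^ k) := by
  obtain ⟨hγ, hC, hfkg, hmix⟩ := h
  have hγ0 : 0 ≤ γ := le_trans (by positivity) hγ.le
  have hL0 : (0 : ℝ) < L := by exact_mod_cast Nat.pos_of_ne_zero hL
  refine integral_sum_centred_pow_le_of_correlation hF hw U hk hL (by positivity)
    fun s x v hv => ?_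
  refine (abs_integral_mul_prod_le_of_fkg hF hw hP hfkg s x v).trans ?_
  calc ∑ j ∈ s, covariance (centred P ψ F x) (centred P ψ F (v j)) P
      ≤ ∑ j ∈ s, C * (L : ℝ) ^ (-γ) := by
        refine Finset.sum_le_sum fun j hj => ?_
        obtain ⟨hne, hd⟩ := hv j hj
        refine (covariance_centred_le hF hw hP hC.le hmix hne).trans ?_
        refine mul_le_mul_of_nonneg_left ?_ hC.le
        exact Real.rpow_le_rpow_of_nonpos hL0 (by exact_mod_cast hd) (by linarith)
    _ = s.card * (C * (L : ℝ) ^ (-γ)) := by rw [Finset.sum_const, nsmul_eq_mul]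
    _ ≤ (2 * k) * (C * (L : ℝ) ^ (-γ)) := by
        have h1 : (s.card : ℝ) ≤ 2 * k := by
          have := s.card_le_univ
          rw [Fintype.card_fin] at this
          exact_mod_cast this
        gcongr
    _ = _ := by ring

theorem CondA3.integral_sum_centred_pow_le [IsProbabilityMeasure P]
    (hF : IsMonotoneObservable d ψ F)
    (hw : ∀ e : Edge d, Measurable fun ω : Env d => weight ω e) (hP : Stationary P) {𝔯 : ℕ}
    (h : CondA3 P 𝔯) (U : Finset (Fin d → ℤ)) {k : ℕ} (hk : k ≠ 0) :
    ∫ ω, (∑ x ∈ U, centred P ψ F x ω) ^ (2 * k) ∂P ≤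
      2 ^ (2 * k) * ((k : ℝ) ^ (2 * k) * ((𝔯 : ℝ) ^ d * U.card) ^ k) := by
  have := integral_sum_centred_pow_le_of_correlation (P := P) hF hw U hk h.1.ne' le_rfl
    fun s x v hv => by
      rw [integral_mul_prod_eq_zero_of_finiteRange hF hw hP h s x v fun j hj => (hv j hj).2,
        abs_zero]
  simpa using this

theorem CondA4.integral_sum_centred_pow_le [IsProbabilityMeasure P]
    (hF : IsMonotoneObservable d ψ F)
    (hw : ∀ e : Edge d, Measurable fun ω : Env d => weight ω e) (hP : Stationary P)
    (h : CondA4 P) (U : Finset (Fin d → ℤ)) {k : ℕ} (hk : k ≠ 0) :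
    ∫ ω, (∑ x ∈ U, centred P ψ F x ω) ^ (2 * k) ∂P ≤
      2 ^ (2 * k) * ((2 * k).factorial * Real.exp 1 * (2 ^ d * U.card) ^ k) := by
  have hcard := card_residue_classes d 2
  push_cast at hcard
  rw [← hcard]
  have := integral_sum_pow_le_of_colouring (P := P) (residue 2) U (centred P ψ F) hk
    (fun x => memLp_centred hF hw x _) le_rfl
    (b := (2 * k).factorial * Real.exp 1) (by positivity) fun c => by
      set V := U.filter fun x => residue 2 x = c with hV
      rw [zero_mul, zero_add]
      rcases eq_or_ne V.card 0 with h0 | h0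
      · rw [Finset.card_eq_zero.1 h0]
        simp [hk]
      have hexp := integral_exp_sum_le_of_negativelyAssociated hF hw hP h V fun x hx y hy hne => by
        have h2 := le_l1_sub_of_residue_eq
          ((Finset.mem_filter.1 hx).2.trans (Finset.mem_filter.1 hy).2.symm) hne
        intro hadj
        have h1 : l1 (x - y) = 1 := hadj
        omega
      exact integral_pow_le_of_mgf_le (fun t => (hexp t).1) h0 (fun t => (hexp t).2) k
  simpa using this

end ObservableMoments

/-! ### Moment bounds from the spectral gap -/

section SpectralGap

variable {d : ℕ}

/-- The regularity of `ψ(w) = w` and `ψ(w) = 1 / w` on `(0,∞)` that is used with the spectral gap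
inequality: `ψ` is positive and `C¹` with `|ψ'| ≤ 1 + ψ²`. -/
structure IsSmoothProfile (ψ : ℝ → ℝ) : Prop where
  measurable : Measurable ψ
  pos : ∀ w, 0 < w → 0 < ψ w
  contDiffOn : ContDiffOn ℝ 1 ψ (Set.Ioi 0)
  abs_deriv_le : ∀ w, 0 < w → |deriv ψ w| ≤ 1 + ψ w ^ 2

variable {ψ : ℝ → ℝ} {p : ℝ}

theorem IsSmoothProfile.hasDerivAt (hψ : IsSmoothProfile ψ) {w : ℝ} (hw : 0 < w) :
    HasDerivAt ψ (deriv ψ w) w :=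
  ((hψ.contDiffOn.differentiableOn one_ne_zero).differentiableAt (Ioi_mem_nhds hw)).hasDerivAt

open Classical in
/-- Only small `t` matter: where `ω(e) + t ≤ 0`, `perturb` leaves the environment unchanged. -/
theorem hasDerivAt_cond_perturb (ω : Env d) (e : Edge d) {x y : Fin d → ℤ}
    (h : (lattice d).Adj x y) :
    HasDerivAt (fun t : ℝ => cond (perturb ω e t) x y)
      (if (⟨s(x, y), h⟩ : Edge d) = e then 1 else 0) 0 := by
  have hev : ∀ᶠ t in 𝓝 (0 : ℝ), 0 < weight ω e + t := by
    have : Tendsto (fun t : ℝ => weight ω e + t) (𝓝 0) (𝓝 (weight ω e + 0)) :=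
      (continuous_const.add continuous_id).tendsto 0
    exact this.eventually (lt_mem_nhds (by rw [add_zero]; exact (ω e).2))
  split_ifs with he
  · refine ((hasDerivAt_id (0 : ℝ)).const_add (weight ω e)).congr_of_eventuallyEq ?_
    filter_upwards [hev] with t ht
    rw [cond_eq_weight _ h, he, weight, perturb, dif_pos ⟨rfl, ht⟩]
    rfl
  · refine (hasDerivAt_const (0 : ℝ) (cond ω x y)).congr_of_eventuallyEq ?_
    filter_upwards with t
    rw [cond_eq_weight _ h, cond_eq_weight _ h, weight, perturb, dif_neg fun H => he H.1]
    rfl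

theorem perturb_zero (ω : Env d) (e : Edge d) : perturb ω e 0 = ω := by
  funext e'
  rw [perturb]
  split_ifs with h
  · obtain ⟨rfl, _⟩ := h
    exact Subtype.ext (add_zero _)
  · rfl

/-- A bound for the vertical derivatives of `(∑_{y ∼ x} ψ(ω(x,y))) ^ p`. -/
noncomputable def gradBound (d : ℕ) (p A : ℝ) : ℝ := 2 * p * 3 ^ d * (1 + A) ^ (p + 1)

theorem one_le_gradBound (d : ℕ) (hp : 1 ≤ p) {A : ℝ} (hA : 0 ≤ A) : 1 ≤ gradBound d p A := by
  have h1 : (1 : ℝ) ≤ 3 ^ d := one_le_pow₀ (by norm_num)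
  have h2 : (1 : ℝ) ≤ (1 + A) ^ (p + 1) := Real.one_le_rpow (by linarith) (by linarith)
  have h3 : (1 : ℝ) ≤ 2 * p := by linarith
  exact one_le_mul_of_one_le_of_one_le (one_le_mul_of_one_le_of_one_le h3 h1) h2

theorem rpow_le_gradBound (d : ℕ) (hp : 1 ≤ p) {A : ℝ} (hA : 0 ≤ A) :
    A ^ p ≤ gradBound d p A := by
  have h1 : (1 : ℝ) ≤ 3 ^ d := one_le_pow₀ (by norm_num)
  have h3 : (1 : ℝ) ≤ 2 * p := by linarith
  calc A ^ p ≤ (1 + A) ^ p := Real.rpow_le_rpow hA (by linarith) (by linarith)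
    _ ≤ (1 + A) ^ (p + 1) := Real.rpow_le_rpow_of_exponent_le (by linarith) (by linarith)
    _ ≤ _ := le_mul_of_one_le_left (Real.rpow_nonneg (by linarith) _)
        (one_le_mul_of_one_le_of_one_le h3 h1)

theorem measurable_gradBound (d : ℕ) (p : ℝ) : Measurable (gradBound d p) := by
  unfold gradBound
  fun_prop

theorem exists_hasDerivAt_siteSum_rpow (hψ : IsSmoothProfile ψ) (hp : 1 ≤ p) (ω : Env d)
    (e : Edge d) (x : Fin d → ℤ) :
    ∃ D : ℝ, HasDerivAt (fun t : ℝ => siteSum ψ (perturb ω e t) x ^ p) D 0 ∧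
      |D| ≤ (if x ∈ e.1 then gradBound d p (siteSum ψ ω x) else 0) := by
  classical
  set A := siteSum ψ ω x with hA
  have hA0 : 0 ≤ A := siteSum_nonneg hψ.pos ω x
  set ι : (Fin d → ℤ) → ℝ := fun y => if s(x, y) = e.1 then 1 else 0 with hι
  have h1 : HasDerivAt (fun t : ℝ => siteSum ψ (perturb ω e t) x)
      (∑ y ∈ nbrs x, deriv ψ (cond ω x y) * ι y) 0 := by
    refine HasDerivAt.fun_sum fun y hy => ?_
    have hadj := (mem_nbrs x y).1 hy
    have h2 := hasDerivAt_cond_perturb ω e hadj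
    have h3 : HasDerivAt ψ (deriv ψ (cond ω x y)) (cond (perturb ω e 0) x y) := by
      rw [perturb_zero]
      exact hψ.hasDerivAt (cond_pos ω hadj)
    have h4 := h3.comp (0 : ℝ) h2
    have h5 : (if (⟨s(x, y), hadj⟩ : Edge d) = e then (1 : ℝ) else 0) = ι y := by
      simp only [hι, Subtype.ext_iff]
    rw [h5] at h4
    exact h4
  have h6 := h1.rpow_const (p := p) (Or.inr hp)
  rw [perturb_zero] at h6
  refine ⟨_, h6, ?_⟩
  split_ifs with hx
  · have hsum : |∑ y ∈ nbrs x, deriv ψ (cond ω x y) * ι y| ≤ 3 ^ d + A ^ 2 := by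
      calc |∑ y ∈ nbrs x, deriv ψ (cond ω x y) * ι y|
          ≤ ∑ y ∈ nbrs x, (1 + ψ (cond ω x y) ^ 2) := by
            refine (Finset.abs_sum_le_sum_abs _ _).trans (Finset.sum_le_sum fun y hy => ?_)
            rw [abs_mul]
            refine (mul_le_of_le_one_right (abs_nonneg _) ?_).trans
              (hψ.abs_deriv_le _ (cond_pos ω ((mem_nbrs x y).1 hy)))
            simp only [hι]
            split_ifs <;> simp
        _ = (nbrs x).card + ∑ y ∈ nbrs x, ψ (cond ω x y) ^ 2 := by
            rw [Finset.sum_add_distrib]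
            simp
        _ ≤ 3 ^ d + A ^ 2 := by
            refine add_le_add (by exact_mod_cast card_nbrs_le x) ?_
            exact Finset.sum_sq_le_sq_sum_of_nonneg fun y hy =>
              (hψ.pos _ (cond_pos ω ((mem_nbrs x y).1 hy))).le
    have h3d : (1 : ℝ) ≤ 3 ^ d := one_le_pow₀ (by norm_num)
    rw [abs_mul, abs_mul, abs_of_nonneg (by linarith : (0 : ℝ) ≤ p),
      abs_of_nonneg (Real.rpow_nonneg hA0 _)]
    calc |∑ y ∈ nbrs x, deriv ψ (cond ω x y) * ι y| * p * A ^ (p - 1)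
        ≤ (3 ^ d + A ^ 2) * p * A ^ (p - 1) := by gcongr
      _ ≤ (2 * 3 ^ d * (1 + A) ^ 2) * p * (1 + A) ^ (p - 1) := by
          gcongr
          · nlinarith
          · linarith
      _ = gradBound d p A := by
          rw [gradBound, show p + 1 = (p - 1) + 2 by ring, Real.rpow_add (by linarith)]
          norm_num
          ring
  · rw [Finset.sum_eq_zero]
    · simp
    · intro y _
      have : s(x, y) ≠ e.1 := fun h => hx (h ▸ Sym2.mem_mk_left _ _)
      simp only [hι, if_neg this, mul_zero]

/-- The factor `2` is the number of endpoints of an edge. -/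
theorem sq_sum_filter_mem_le (U : Finset (Fin d → ℤ)) (e : Edge d) (B : (Fin d → ℤ) → ℝ) :
    (∑ x ∈ U, if x ∈ e.1 then B x else 0) ^ 2
      ≤ 2 * ∑ x ∈ U, if x ∈ e.1 then B x ^ 2 else 0 := by
  rw [← Finset.sum_filter, ← Finset.sum_filter]
  refine sq_sum_le_card_mul_sum_sq.trans ?_
  refine mul_le_mul_of_nonneg_right ?_ (Finset.sum_nonneg fun x _ => sq_nonneg _)
  obtain ⟨e, he⟩ := e
  induction e with
  | _ a b =>
    have h1 : U.filter (fun x => x ∈ s(a, b)) ⊆ {a, b} := fun x hx => by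
      have := (Finset.mem_filter.1 hx).2
      simpa using this
    exact_mod_cast (Finset.card_le_card h1).trans Finset.card_le_two

/-- The limsup in the vertical derivative is a limit, since the sum is differentiable in each
conductance. -/
theorem vertDeriv_sum_pow_sq_le (hψ : IsSmoothProfile ψ) (hp : 1 ≤ p) (m : ℝ)
    (U : Finset (Fin d → ℤ)) (k : ℕ) (ω : Env d) (e : Edge d) :
    vertDeriv e (fun ω => (∑ x ∈ U, (siteSum ψ ω x ^ p - m)) ^ k) ω ^ 2 ≤
      ∑ x ∈ U, if x ∈ e.1 then 2 * (k : ℝ) ^ 2 * (((∑ x ∈ U, (siteSum ψ ω x ^ p - m)) ^ (k - 1)) ^ 2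
        * gradBound d p (siteSum ψ ω x) ^ 2) else 0 := by
  choose D hD hDb using exists_hasDerivAt_siteSum_rpow hψ hp ω e
  set S : Env d → ℝ := fun ω => ∑ x ∈ U, (siteSum ψ ω x ^ p - m) with hS
  have h1 : HasDerivAt (fun t : ℝ => S (perturb ω e t)) (∑ x ∈ U, D x) 0 :=
    HasDerivAt.fun_sum fun x _ => (hD x).sub_const m
  have h2 : HasDerivAt (fun t : ℝ => S (perturb ω e t) ^ k)
      (k * S ω ^ (k - 1) * ∑ x ∈ U, D x) 0 := by
    have := h1.fun_pow k
    rwa [perturb_zero] at this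
  have h3 : vertDeriv e (fun ω => S ω ^ k) ω = k * S ω ^ (k - 1) * ∑ x ∈ U, D x := by
    have h4 := h2.tendsto_slope_zero
    simp only [zero_add, perturb_zero, smul_eq_mul] at h4
    rw [vertDeriv]
    refine Tendsto.limsup_eq ?_
    simpa only [div_eq_inv_mul] using h4
  rw [h3]
  have h5 : (∑ x ∈ U, D x) ^ 2 ≤
      2 * ∑ x ∈ U, if x ∈ e.1 then gradBound d p (siteSum ψ ω x) ^ 2 else 0 := by
    refine le_trans ?_ (sq_sum_filter_mem_le U e fun x => gradBound d p (siteSum ψ ω x))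
    rw [sq_le_sq]
    refine (Finset.abs_sum_le_sum_abs _ _).trans ((Finset.sum_le_sum fun x _ => hDb x).trans ?_)
    exact le_abs_self _
  calc (k * S ω ^ (k - 1) * ∑ x ∈ U, D x) ^ 2
      = (k : ℝ) ^ 2 * (S ω ^ (k - 1)) ^ 2 * (∑ x ∈ U, D x) ^ 2 := by ring
    _ ≤ (k : ℝ) ^ 2 * (S ω ^ (k - 1)) ^ 2 *
        (2 * ∑ x ∈ U, if x ∈ e.1 then gradBound d p (siteSum ψ ω x) ^ 2 else 0) := by gcongr
    _ = _ := by
        rw [Finset.mul_sum, Finset.mul_sum]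
        refine Finset.sum_congr rfl fun x _ => ?_
        split_ifs
        · ring
        · ring

theorem isLocalC1_sum_pow (hψ : IsSmoothProfile ψ) (hp : 1 ≤ p) (m : ℝ) (U : Finset (Fin d → ℤ))
    (k : ℕ) : IsLocalC1 fun ω : Env d => (∑ x ∈ U, (siteSum ψ ω x ^ p - m)) ^ k := by
  classical
  set A : Finset (Edge d) := U.biUnion edgesAt with hA
  set c : (A → ℝ) → (Fin d → ℤ) → (Fin d → ℤ) → ℝ := fun v x y =>
    if h : ∃ hadj : (lattice d).Adj x y, (⟨s(x, y), hadj⟩ : Edge d) ∈ A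
      then v ⟨⟨s(x, y), h.1⟩, h.2⟩ else 1 with hc
  have hcs : ∀ x y, ContDiff ℝ 1 fun v => c v x y := fun x y => by
    by_cases h : ∃ hadj : (lattice d).Adj x y, (⟨s(x, y), hadj⟩ : Edge d) ∈ A
    · simp only [hc, dif_pos h]
      exact contDiff_apply ℝ ℝ _
    · simp only [hc, dif_neg h]
      exact contDiff_const
  have hcpos : ∀ v : A → ℝ, (∀ e, 0 < v e) → ∀ x y, 0 < c v x y := fun v hv x y => by
    simp only [hc]
    split_ifs
    · exact hv _
    · exact one_pos
  refine ⟨A, fun v => (∑ x ∈ U, ((∑ y ∈ nbrs x, ψ (c v x y)) ^ p - m)) ^ k, ?_, fun ω => ?_⟩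
  · refine ContDiffOn.pow (ContDiffOn.sum fun x _ => ContDiffOn.sub ?_ contDiffOn_const) k
    refine (Real.contDiff_rpow_const_of_le (n := 1) (by exact_mod_cast hp)).comp_contDiffOn
      (ContDiffOn.sum fun y _ => ?_)
    exact hψ.contDiffOn.comp (hcs x y).contDiffOn fun v hv => hcpos v hv x y
  · refine congrArg (fun u : ℝ => u ^ k) (Finset.sum_congr rfl fun x hx => ?_)
    refine congrArg (fun u : ℝ => u ^ p - m) (Finset.sum_congr rfl fun y hy => ?_)
    have hadj := (mem_nbrs x y).1 hy
    have h : ∃ hadj : (lattice d).Adj x y, (⟨s(x, y), hadj⟩ : Edge d) ∈ A :=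
      ⟨hadj, Finset.mem_biUnion.2 ⟨x, hx, mem_edgesAt.2 (Sym2.mem_mk_left _ _)⟩⟩
    simp only [hc, dif_pos h, cond_eq_weight ω hadj]

end SpectralGap

section SpectralGapMoments

/-- A form of Young's inequality, proved by comparing `b ^ 2` with `τ * s ^ 2`. -/
theorem pow_pred_sq_mul_sq_le {k : ℕ} (hk : k ≠ 0) {τ : ℝ} (hτ : 0 < τ) (s b : ℝ) :
    (s ^ (k - 1)) ^ 2 * b ^ 2 ≤ τ * s ^ (2 * k) + (τ⁻¹) ^ (k - 1) * b ^ (2 * k) := by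
  obtain ⟨j, rfl⟩ := Nat.exists_eq_succ_of_ne_zero hk
  simp only [Nat.succ_eq_add_one, Nat.add_sub_cancel]
  have e1 : ∀ u : ℝ, u ^ (2 * (j + 1)) = (u ^ 2) ^ j * u ^ 2 := fun u => by
    rw [pow_mul, pow_succ]
  have e2 : (s ^ j) ^ 2 = (s ^ 2) ^ j := by rw [← pow_mul, ← pow_mul, mul_comm]
  rw [e1, e1, e2]
  have hs : 0 ≤ (s ^ 2) ^ j := by positivity
  have hb : 0 ≤ (b ^ 2) ^ j := by positivity
  rcases le_total (b ^ 2) (τ * s ^ 2) with h | h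
  · have h1 : 0 ≤ (τ⁻¹) ^ j * ((b ^ 2) ^ j * b ^ 2) := by positivity
    nlinarith [mul_le_mul_of_nonneg_left h hs]
  · have h1 : (s ^ 2) ^ j ≤ (τ⁻¹) ^ j * (b ^ 2) ^ j := by
      rw [← mul_pow]
      refine pow_le_pow_left₀ (sq_nonneg s) ?_ j
      rw [inv_mul_eq_div, le_div_iff₀ hτ, mul_comm]
      exact h
    have h2 : 0 ≤ τ * ((s ^ 2) ^ j * s ^ 2) := by positivity
    nlinarith [mul_le_mul_of_nonneg_right h1 (sq_nonneg b)]

/-- Each site lies on at most `3 ^ d` edges, so a gradient that charges only the edges at sites of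
`U` has total size of order `|U|`. -/
theorem tsum_sum_ite_mem_le {d : ℕ} (U : Finset (Fin d → ℤ)) {I : ℝ} (hI : 0 ≤ I) :
    ∑' e : Edge d, ENNReal.ofReal (∑ x ∈ U, if x ∈ e.1 then I else 0)
      ≤ ENNReal.ofReal (U.card * 3 ^ d * I) := by
  classical
  have h1 : ∀ e : Edge d, ENNReal.ofReal (∑ x ∈ U, if x ∈ e.1 then I else 0)
      = ∑ x ∈ U, if x ∈ e.1 then ENNReal.ofReal I else 0 := fun e => by
    rw [ENNReal.ofReal_sum_of_nonneg fun x _ => by split_ifs <;> simp [hI]]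
    refine Finset.sum_congr rfl fun x _ => ?_
    split_ifs <;> simp
  simp_rw [h1]
  rw [Summable.tsum_finsetSum fun x _ => ENNReal.summable]
  have h2 : ∀ x : Fin d → ℤ, ∑' e : Edge d, (if x ∈ e.1 then ENNReal.ofReal I else 0)
      ≤ ENNReal.ofReal (3 ^ d * I) := fun x => by
    rw [tsum_eq_sum (s := edgesAt x) fun e he => if_neg fun h => he (mem_edgesAt.2 h)]
    refine (Finset.sum_le_card_nsmul _ _ (ENNReal.ofReal I) fun e _ => ?_).trans ?_
    · split_ifs <;> simp
    · rw [nsmul_eq_mul, ← ENNReal.ofReal_natCast, ← ENNReal.ofReal_mul (Nat.cast_nonneg _)]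
      refine ENNReal.ofReal_le_ofReal (mul_le_mul_of_nonneg_right ?_ hI)
      exact_mod_cast card_edgesAt_le x
  refine (Finset.sum_le_card_nsmul _ _ _ fun x _ => h2 x).trans ?_
  rw [nsmul_eq_mul, ← ENNReal.ofReal_natCast, ← ENNReal.ofReal_mul (Nat.cast_nonneg _), mul_assoc]

variable {d : ℕ} [MeasurableSpace (Env d)] {P : Measure (Env d)} {ψ : ℝ → ℝ} {p : ℝ}

/-- The spectral gap inequality for the `k`-th power of a sum `S`. Young's inequality lets half of
`E[S ^ (2k)]` be absorbed, which is finite by the moment assumption. -/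
theorem CondA2.integral_sum_pow_le_sq [IsProbabilityMeasure P] {C : ℝ} (h : CondA2 P C)
    (hψ : IsSmoothProfile ψ) (hp : 1 ≤ p)
    (hw : ∀ e : Edge d, Measurable fun ω : Env d => weight ω e) (m : ℝ)
    (U : Finset (Fin d → ℤ)) (hU : U.Nonempty) {k : ℕ} (hk : k ≠ 0) {β : ℝ}
    (hBi : ∀ x, Integrable (fun ω => gradBound d p (siteSum ψ ω x) ^ (2 * k)) P)
    (hBβ : ∀ x, ∫ ω, gradBound d p (siteSum ψ ω x) ^ (2 * k) ∂P ≤ β) :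
    ∫ ω, (∑ x ∈ U, (siteSum ψ ω x ^ p - m)) ^ (2 * k) ∂P ≤
      2 * (∫ ω, (∑ x ∈ U, (siteSum ψ ω x ^ p - m)) ^ k ∂P) ^ 2
        + (4 * C * 3 ^ d * k ^ 2 * U.card) ^ k * β := by
  obtain ⟨hC, hgap⟩ := h
  have hA0 : ∀ (ω : Env d) x, 0 ≤ siteSum ψ ω x := fun ω x => siteSum_nonneg hψ.pos ω x
  have hAm := measurable_siteSum hw hψ.measurable
  have hXm : ∀ x, Measurable fun ω : Env d => siteSum ψ ω x ^ p := fun x =>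
    (hAm x).pow_const p
  have hXL : ∀ x, MemLp (fun ω => siteSum ψ ω x ^ p - m) ((2 * k : ℕ) : ENNReal) P := fun x => by
    refine MemLp.sub (memLp_of_integrable_pow hk (hXm x).aestronglyMeasurable ?_) (memLp_const m)
    refine (hBi x).mono' ((hXm x).pow_const _).aestronglyMeasurable (ae_of_all _ fun ω => ?_)
    have h0 : 0 ≤ siteSum ψ ω x ^ p := Real.rpow_nonneg (hA0 ω x) _
    rw [Real.norm_eq_abs, abs_of_nonneg (pow_nonneg h0 _)]
    exact pow_le_pow_left₀ h0 (rpow_le_gradBound d hp (hA0 ω x)) _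
  set S : Env d → ℝ := fun ω => ∑ x ∈ U, (siteSum ψ ω x ^ p - m) with hS
  have hSm : Measurable S := Finset.measurable_fun_sum _ fun x _ => (hXm x).sub_const m
  have hSL : MemLp S ((2 * k : ℕ) : ENNReal) P := memLp_finsetSum U fun x _ => hXL x
  have hSi : Integrable (fun ω => S ω ^ (2 * k)) P := integrable_pow_of_memLp hk hSL
  have hfL : MemLp (fun ω => S ω ^ k) 2 P := by
    rw [memLp_two_iff_integrable_sq (hSm.pow_const k).aestronglyMeasurable]
    refine hSi.congr (ae_of_all _ fun ω => ?_)
    change S ω ^ (2 * k) = (S ω ^ k) ^ 2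
    rw [← pow_mul, mul_comm]
  set M := ∫ ω, S ω ^ (2 * k) ∂P with hM
  have hM0 : 0 ≤ M := integral_nonneg fun ω => (even_two_mul k).pow_nonneg _
  have hβ0 : 0 ≤ β := le_trans (integral_nonneg fun ω => (even_two_mul k).pow_nonneg _) (hBβ 0)
  have hn : (0 : ℝ) < U.card := by exact_mod_cast hU.card_pos
  have hk0 : (0 : ℝ) < k := by exact_mod_cast Nat.pos_of_ne_zero hk
  -- with this choice of `τ`, the term `τ * M` contributes `M / 2`
  set Q : ℝ := C * (U.card * 3 ^ d * (2 * (k : ℝ) ^ 2)) with hQ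
  have hQ0 : 0 < Q := by positivity
  set τ : ℝ := (2 * Q)⁻¹ with hτ
  have hτ0 : 0 < τ := by positivity
  set I : ℝ := 2 * (k : ℝ) ^ 2 * (τ * M + (τ⁻¹) ^ (k - 1) * β) with hI
  have hI0 : 0 ≤ I := by positivity
  set Y : (Fin d → ℤ) → Env d → ℝ := fun x ω => 2 * (k : ℝ) ^ 2 * (τ * S ω ^ (2 * k)
    + (τ⁻¹) ^ (k - 1) * gradBound d p (siteSum ψ ω x) ^ (2 * k)) with hY
  have hY0 : ∀ x ω, 0 ≤ Y x ω := fun x ω => by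
    have h1 : 0 ≤ S ω ^ (2 * k) := (even_two_mul k).pow_nonneg _
    have h2 : 0 ≤ gradBound d p (siteSum ψ ω x) ^ (2 * k) := (even_two_mul k).pow_nonneg _
    positivity
  have hYi : ∀ x, Integrable (Y x) P := fun x =>
    ((hSi.const_mul τ).add ((hBi x).const_mul _)).const_mul _
  have hYI : ∀ x, ∫ ω, Y x ω ∂P ≤ I := fun x => by
    simp only [hY]
    rw [integral_const_mul, integral_add (hSi.const_mul τ) ((hBi x).const_mul _),
      integral_const_mul, integral_const_mul]
    exact mul_le_mul_of_nonneg_left (add_le_add le_rfl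
      (mul_le_mul_of_nonneg_left (hBβ x) (by positivity))) (by positivity)
  have hvert : ∀ e : Edge d, ∫⁻ ω, ENNReal.ofReal (vertDeriv e (fun ω => S ω ^ k) ω ^ 2) ∂P
      ≤ ENNReal.ofReal (∑ x ∈ U, if x ∈ e.1 then I else 0) := fun e => by
    have hint : ∀ x ∈ U, Integrable (fun ω => if x ∈ e.1 then Y x ω else 0) P := fun x _ => by
      split_ifs
      · exact hYi x
      · exact integrable_zero _ _ _
    calc ∫⁻ ω, ENNReal.ofReal (vertDeriv e (fun ω => S ω ^ k) ω ^ 2) ∂P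
        ≤ ∫⁻ ω, ENNReal.ofReal (∑ x ∈ U, if x ∈ e.1 then Y x ω else 0) ∂P := by
          refine lintegral_mono fun ω => ENNReal.ofReal_le_ofReal ?_
          refine (vertDeriv_sum_pow_sq_le hψ hp m U k ω e).trans ?_
          refine Finset.sum_le_sum fun x _ => ?_
          split_ifs
          · exact mul_le_mul_of_nonneg_left (pow_pred_sq_mul_sq_le hk hτ0 _ _) (by positivity)
          · exact le_rfl
      _ = ENNReal.ofReal (∫ ω, ∑ x ∈ U, (if x ∈ e.1 then Y x ω else 0) ∂P) := by
          refine (ofReal_integral_eq_lintegral_ofReal (integrable_finsetSum U hint)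
            (ae_of_all _ fun ω => Finset.sum_nonneg fun x _ => ?_)).symm
          change 0 ≤ if x ∈ e.1 then Y x ω else 0
          split_ifs
          · exact hY0 x ω
          · exact le_rfl
      _ ≤ _ := by
          refine ENNReal.ofReal_le_ofReal ?_
          rw [integral_finsetSum U hint]
          refine Finset.sum_le_sum fun x _ => ?_
          split_ifs
          · exact hYI x
          · simp
  have hmain : ∫ ω, (S ω ^ k - ∫ ω', S ω' ^ k ∂P) ^ 2 ∂P ≤ C * (U.card * 3 ^ d * I) := by
    rw [← ENNReal.ofReal_le_ofReal_iff (by positivity), ENNReal.ofReal_mul hC.le]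
    refine (hgap _ (isLocalC1_sum_pow hψ hp m U k) hfL).trans (mul_le_mul_right ?_ _)
    exact (ENNReal.tsum_le_tsum hvert).trans (tsum_sum_ite_mem_le U hI0)
  have hvar : ∫ ω, (S ω ^ k - ∫ ω', S ω' ^ k ∂P) ^ 2 ∂P = M - (∫ ω, S ω ^ k ∂P) ^ 2 := by
    rw [← variance_eq_integral (hSm.pow_const k).aemeasurable, variance_eq_sub hfL]
    congr 1
    refine integral_congr_ae (ae_of_all _ fun ω => ?_)
    change (S ω ^ k) ^ 2 = S ω ^ (2 * k)
    rw [← pow_mul, mul_comm]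
  have hrhs : C * (U.card * 3 ^ d * I) = M / 2 + Q * (2 * Q) ^ (k - 1) * β := by
    have h1 : C * (U.card * 3 ^ d * I) = Q * (τ * M + (τ⁻¹) ^ (k - 1) * β) := by
      rw [hI, hQ]; ring
    have h2 : Q * τ = 1 / 2 := by rw [hτ]; field_simp
    have h3 : τ⁻¹ = 2 * Q := by rw [hτ, inv_inv]
    rw [h1, h3, mul_add, ← mul_assoc, h2]
    ring
  rw [hvar, hrhs] at hmain
  have hQk : (4 * C * 3 ^ d * (k : ℝ) ^ 2 * U.card) ^ k = 2 * (Q * (2 * Q) ^ (k - 1)) := by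
    obtain ⟨j, rfl⟩ := Nat.exists_eq_succ_of_ne_zero hk
    have : 4 * C * 3 ^ d * ((j.succ : ℕ) : ℝ) ^ 2 * U.card = 2 * Q := by rw [hQ]; ring
    rw [this, Nat.succ_eq_add_one, Nat.add_sub_cancel]
    ring
  rw [hQk]
  linarith

/-- The constants for the exponents `2 * 2 ^ j` produced by iterating
`CondA2.integral_sum_pow_le_sq`; `β` bounds the gradient moments. -/
noncomputable def gapConst (D β : ℝ) : ℕ → ℝ
  | 0 => D * β
  | j + 1 => 2 * gapConst D β j ^ 2 + (D * (2 ^ (j + 1)) ^ 2) ^ (2 ^ (j + 1)) * β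

theorem gapConst_nonneg {D β : ℝ} (hD : 0 ≤ D) (hβ : 0 ≤ β) (j : ℕ) : 0 ≤ gapConst D β j := by
  cases j with
  | zero => exact mul_nonneg hD hβ
  | succ j => rw [gapConst]; positivity

/-- Induction over the exponents `2, 4, 8, …`: the mean of `S ^ k` in the spectral gap inequality is
the moment estimated one step before, and for `k = 1` it vanishes. -/
theorem CondA2.integral_sum_pow_le [IsProbabilityMeasure P] {C : ℝ} (h : CondA2 P C)
    (hψ : IsSmoothProfile ψ) (hp : 1 ≤ p)
    (hw : ∀ e : Edge d, Measurable fun ω : Env d => weight ω e) {m : ℝ}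
    (hm : ∀ x, ∫ ω, siteSum ψ ω x ^ p ∂P = m) (hmi : ∀ x, Integrable (fun ω => siteSum ψ ω x ^ p) P)
    (U : Finset (Fin d → ℤ)) {J : ℕ} {β : ℝ}
    (hBi : ∀ x, Integrable (fun ω => gradBound d p (siteSum ψ ω x) ^ (2 * 2 ^ J)) P)
    (hBβ : ∀ x, ∫ ω, gradBound d p (siteSum ψ ω x) ^ (2 * 2 ^ J) ∂P ≤ β) (j : ℕ) (hj : j ≤ J) :
    ∫ ω, (∑ x ∈ U, (siteSum ψ ω x ^ p - m)) ^ (2 * 2 ^ j) ∂P ≤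
      gapConst (4 * C * 3 ^ d) β j * (U.card : ℝ) ^ (2 ^ j) := by
  have hC := h.1
  have hA0 : ∀ (ω : Env d) x, 0 ≤ siteSum ψ ω x := fun ω x => siteSum_nonneg hψ.pos ω x
  rcases U.eq_empty_or_nonempty with rfl | hU
  · simp
  have hle : ∀ i ≤ J, ∀ ω x, gradBound d p (siteSum ψ ω x) ^ (2 * 2 ^ i)
      ≤ gradBound d p (siteSum ψ ω x) ^ (2 * 2 ^ J) := fun i hi ω x =>
    pow_le_pow_right₀ (one_le_gradBound d hp (hA0 ω x))
      (Nat.mul_le_mul_left 2 (Nat.pow_le_pow_right two_pos hi))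
  have hi' : ∀ i ≤ J, ∀ x, Integrable (fun ω => gradBound d p (siteSum ψ ω x) ^ (2 * 2 ^ i)) P :=
    fun i hi x => (hBi x).mono' (((measurable_gradBound d p).comp
      (measurable_siteSum hw hψ.measurable x)).pow_const _).aestronglyMeasurable
      (ae_of_all _ fun ω => by
        rw [Real.norm_eq_abs, abs_of_nonneg ((even_two_mul _).pow_nonneg _)]
        exact hle i hi ω x)
  have hβ' : ∀ i ≤ J, ∀ x, ∫ ω, gradBound d p (siteSum ψ ω x) ^ (2 * 2 ^ i) ∂P ≤ β :=
    fun i hi x => (integral_mono (hi' i hi x) (hBi x) fun ω => hle i hi ω x).trans (hBβ x)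
  have hβ0 : 0 ≤ β := le_trans (integral_nonneg fun ω => (even_two_mul _).pow_nonneg _) (hBβ 0)
  induction j with
  | zero =>
    have h1 := h.integral_sum_pow_le_sq hψ hp hw m U hU (k := 2 ^ 0) (by norm_num)
      (hi' 0 hj) (hβ' 0 hj)
    have h2 : ∫ ω, (∑ x ∈ U, (siteSum ψ ω x ^ p - m)) ^ 2 ^ 0 ∂P = 0 := by
      simp only [pow_zero, pow_one]
      have hsub : ∀ x ∈ U, Integrable (fun ω => siteSum ψ ω x ^ p - m) P := fun x _ =>
        (hmi x).sub (integrable_const m)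
      rw [integral_finsetSum U hsub]
      refine Finset.sum_eq_zero fun x _ => ?_
      rw [integral_sub (hmi x) (integrable_const m), hm x]
      simp
    rw [h2] at h1
    refine h1.trans (le_of_eq ?_)
    rw [gapConst]
    push_cast
    ring
  | succ j ih =>
    have ih' := ih (by omega)
    have h1 := h.integral_sum_pow_le_sq hψ hp hw m U hU (k := 2 ^ (j + 1)) (by positivity)
      (hi' _ hj) (hβ' _ hj)
    refine h1.trans ?_
    rw [← pow_succ'] at ih'
    have h0 : 0 ≤ ∫ ω, (∑ x ∈ U, (siteSum ψ ω x ^ p - m)) ^ 2 ^ (j + 1) ∂P :=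
      integral_nonneg fun ω => by
        change 0 ≤ (∑ x ∈ U, (siteSum ψ ω x ^ p - m)) ^ 2 ^ (j + 1)
        rw [pow_succ']
        exact (even_two_mul _).pow_nonneg _
    calc _ ≤ 2 * (gapConst (4 * C * 3 ^ d) β j * (U.card : ℝ) ^ (2 ^ j)) ^ 2
          + (4 * C * 3 ^ d * ((2 ^ (j + 1) : ℕ) : ℝ) ^ 2 * U.card) ^ (2 ^ (j + 1)) * β := by
          gcongr
      _ = _ := by
          rw [gapConst, mul_pow, mul_pow _ (U.card : ℝ), ← pow_mul (U.card : ℝ), ← pow_succ]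
          push_cast
          ring

end SpectralGapMoments

/-! ### Choice of the exponents -/

section Exponents

/-- Conditions on the parameters of the proof: for sums over `n` sites the truncation level is
`n ^ ε`, the spacing of the colour classes under (A1) is `n ^ ((1 - δ) / d)`, and `2k`-th moments
are estimated. The fields `mixing` and `diffusive` say that the products with an isolated variable,
respectively those without, contribute at most `n ^ (2k - ζ)`, truncation level included. -/
structure AdmissibleExponents (d : ℕ) (ζ γ δ ε : ℝ) (k : ℕ) : Prop where
  delta_pos : 0 < δ
  delta_le_one : δ ≤ 1
  eps_pos : 0 < ε
  mixing : ζ < γ / d → ζ + 2 * k * ε ≤ (1 - δ) * (γ / d)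
  diffusive : ζ + 2 * k * ε ≤ k * δ

theorem exists_admissibleExponents (d : ℕ) {ζ : ℝ} (γ : ℝ) (hζ : 1 ≤ ζ) :
    ∃ (δ ε : ℝ) (J : ℕ), AdmissibleExponents d ζ γ δ ε (2 ^ J) := by
  -- `s` is the decay rate per volume; without (A1) its value is irrelevant
  obtain ⟨s, hs, hsγ⟩ : ∃ s : ℝ, ζ < s ∧ (ζ < γ / d → s = γ / d) := by
    by_cases h : ζ < γ / d
    · exact ⟨γ / d, h, fun _ => rfl⟩
    · exact ⟨ζ + 1, by linarith, fun h' => absurd h' h⟩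
  have hs0 : 0 < s := by linarith
  set δ := (s - ζ) / (2 * s) with hδ
  have hδ0 : 0 < δ := div_pos (by linarith) (by linarith)
  have hδs : δ * s = (s - ζ) / 2 := by rw [hδ]; field_simp
  obtain ⟨J, hJ⟩ := pow_unbounded_of_one_lt (2 * ζ / δ) (one_lt_two (α := ℝ))
  rw [div_lt_iff₀ hδ0] at hJ
  set k : ℝ := 2 ^ J with hk
  have hk0 : 0 < k := by positivity
  set ε := min ((s - ζ) / (4 * k)) (δ / 4) with hε
  have hε0 : 0 < ε := lt_min (div_pos (by linarith) (by linarith)) (by linarith)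
  have hε1 : 2 * k * ε ≤ (s - ζ) / 2 := by
    have : ε ≤ (s - ζ) / (4 * k) := min_le_left _ _
    rw [le_div_iff₀ (by linarith)] at this
    linarith
  have hε2 : 2 * k * ε ≤ k * δ / 2 := by
    have : ε ≤ δ / 4 := min_le_right _ _
    nlinarith
  refine ⟨δ, ε, J, hδ0, ?_, hε0, fun h => ?_, ?_⟩
  · rw [hδ, div_le_one (by linarith)]
    linarith
  · push_cast
    rw [← hsγ h]
    linarith
  · push_cast
    linarith

variable {d : ℕ} {ζ γ δ ε : ℝ} {k : ℕ}

theorem AdmissibleExponents.le_natCast (h : AdmissibleExponents d ζ γ δ ε k) : ζ ≤ k := by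
  have h1 := h.diffusive
  have h2 := h.delta_le_one
  have h3 := h.eps_pos
  have h4 : (0 : ℝ) ≤ k := Nat.cast_nonneg k
  nlinarith [mul_nonneg h4 h3.le]

theorem AdmissibleExponents.rpow_mul_rpow_mixing_le (h : AdmissibleExponents d ζ γ δ ε k)
    (hγ : ζ < γ / d) {n : ℝ} (hn : 1 ≤ n) :
    (n ^ ε) ^ (2 * k) * (n ^ (-((1 - δ) * (γ / d))) * n ^ (2 * k)) ≤ n ^ (2 * k - ζ) := by
  have hn0 : 0 < n := by linarith
  rw [← Real.rpow_natCast, ← Real.rpow_mul hn0.le, ← Real.rpow_natCast n, ← Real.rpow_add hn0,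
    ← Real.rpow_add hn0]
  refine Real.rpow_le_rpow_of_exponent_le hn ?_
  have := h.mixing hγ
  push_cast
  linarith

theorem AdmissibleExponents.rpow_mul_pow_diffusive_le (h : AdmissibleExponents d ζ γ δ ε k)
    {n : ℝ} (hn : 1 ≤ n) :
    (n ^ ε) ^ (2 * k) * (n ^ (1 - δ) * n) ^ k ≤ n ^ (2 * k - ζ) := by
  have hn0 : 0 < n := by linarith
  have e1 : n ^ (1 - δ) * n = n ^ (2 - δ) := by
    rw [← Real.rpow_add_one hn0.ne']
    congr 1
    ring
  rw [e1, ← Real.rpow_natCast, ← Real.rpow_mul hn0.le, ← Real.rpow_natCast (n ^ (2 - δ)),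
    ← Real.rpow_mul hn0.le, ← Real.rpow_add hn0]
  refine Real.rpow_le_rpow_of_exponent_le hn ?_
  have := h.diffusive
  push_cast
  linarith

theorem AdmissibleExponents.rpow_mul_pow_le (h : AdmissibleExponents d ζ γ δ ε k)
    {n : ℝ} (hn : 1 ≤ n) : (n ^ ε) ^ (2 * k) * n ^ k ≤ n ^ (2 * k - ζ) := by
  refine le_trans ?_ (h.rpow_mul_pow_diffusive_le hn)
  refine mul_le_mul_of_nonneg_left ?_ (by positivity)
  refine pow_le_pow_left₀ (by linarith) ?_ k
  exact le_mul_of_one_le_left (by linarith)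
    (Real.one_le_rpow hn (by linarith [h.delta_le_one]))

end Exponents

/-! ### The moment bounds under each of the four conditions -/

section Assembly

variable {d : ℕ} [MeasurableSpace (Env d)] {P : Measure (Env d)} {ψ F : ℝ → ℝ}
  {ζ γ δ ε : ℝ} {k : ℕ}

theorem CondA1.rpow_mul_integral_le [IsProbabilityMeasure P] (hd : d ≠ 0)
    (hE : AdmissibleExponents d ζ γ δ ε k) (hk : k ≠ 0) (hγ : ζ < γ / d)
    (hF : IsMonotoneObservable d ψ F)
    (hw : ∀ e : Edge d, Measurable fun ω : Env d => weight ω e) (hP : Stationary P) {C : ℝ}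
    (h : CondA1 P γ C) (U : Finset (Fin d → ℤ)) (hU : U.Nonempty) :
    ((U.card : ℝ) ^ ε) ^ (2 * k) * ∫ ω, (∑ x ∈ U, centred P ψ F x ω) ^ (2 * k) ∂P ≤
      2 ^ (2 * k) * (2 * k * C + k ^ (2 * k) * (2 ^ d) ^ k) * (U.card : ℝ) ^ (2 * k - ζ) := by
  set n : ℝ := (U.card : ℝ) with hn
  have hn1 : 1 ≤ n := by rw [hn]; exact_mod_cast hU.card_pos
  have hn0 : 0 < n := by linarith
  have hd0 : (0 : ℝ) < d := by exact_mod_cast Nat.pos_of_ne_zero hd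
  have hγ0 : 0 ≤ γ := le_trans (by positivity) h.1.le
  have hC0 : 0 ≤ C := h.2.1.le
  set ℓ : ℝ := n ^ ((1 - δ) / d) with hℓ
  have hℓ1 : 1 ≤ ℓ := Real.one_le_rpow hn1 (div_nonneg (by linarith [hE.delta_le_one]) hd0.le)
  -- the spacing of the colour classes
  set L : ℕ := ⌈ℓ⌉₊ with hL
  have hL0 : L ≠ 0 := (Nat.ceil_pos.2 (by linarith)).ne'
  have hLℓ : ℓ ≤ L := Nat.le_ceil ℓ
  have hL2 : (L : ℝ) ≤ 2 * ℓ := by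
    have := Nat.ceil_lt_add_one (by linarith : 0 ≤ ℓ)
    linarith
  have h1 : (L : ℝ) ^ (-γ) ≤ n ^ (-((1 - δ) * (γ / d))) := by
    refine (Real.rpow_le_rpow_of_nonpos (by linarith) hLℓ (by linarith)).trans (le_of_eq ?_)
    rw [hℓ, ← Real.rpow_mul hn0.le]
    congr 1
    ring
  have h2 : (L : ℝ) ^ d ≤ 2 ^ d * n ^ (1 - δ) := by
    refine (pow_le_pow_left₀ (Nat.cast_nonneg _) hL2 d).trans (le_of_eq ?_)
    rw [mul_pow, hℓ, ← Real.rpow_natCast (n ^ ((1 - δ) / d)), ← Real.rpow_mul hn0.le]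
    congr 2
    field_simp
  have h3 := hE.rpow_mul_rpow_mixing_le hγ hn1
  have h4 := hE.rpow_mul_pow_diffusive_le hn1
  set T := (n ^ ε) ^ (2 * k) with hT
  have hT0 : 0 ≤ T := by positivity
  calc T * ∫ ω, (∑ x ∈ U, centred P ψ F x ω) ^ (2 * k) ∂P
      ≤ T * (2 ^ (2 * k) * (2 * k * C * n ^ (-((1 - δ) * (γ / d))) * n ^ (2 * k)
        + (k : ℝ) ^ (2 * k) * ((2 ^ d * n ^ (1 - δ)) * n) ^ k)) := by
        refine mul_le_mul_of_nonneg_left ?_ hT0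
        refine (h.integral_sum_centred_pow_le hF hw hP U hk hL0).trans ?_
        gcongr
    _ = 2 ^ (2 * k) * (2 * k * C * (T * (n ^ (-((1 - δ) * (γ / d))) * n ^ (2 * k)))
        + (k : ℝ) ^ (2 * k) * (2 ^ d) ^ k * (T * (n ^ (1 - δ) * n) ^ k)) := by
        rw [mul_assoc (2 ^ d : ℝ), mul_pow (2 ^ d : ℝ)]
        ring
    _ ≤ 2 ^ (2 * k) * (2 * k * C * n ^ (2 * k - ζ)
        + (k : ℝ) ^ (2 * k) * (2 ^ d) ^ k * n ^ (2 * k - ζ)) := by gcongr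
    _ = _ := by ring

theorem CondA3.rpow_mul_integral_le [IsProbabilityMeasure P]
    (hE : AdmissibleExponents d ζ γ δ ε k) (hk : k ≠ 0) (hF : IsMonotoneObservable d ψ F)
    (hw : ∀ e : Edge d, Measurable fun ω : Env d => weight ω e) (hP : Stationary P) {𝔯 : ℕ}
    (h : CondA3 P 𝔯) (U : Finset (Fin d → ℤ)) (hU : U.Nonempty) :
    ((U.card : ℝ) ^ ε) ^ (2 * k) * ∫ ω, (∑ x ∈ U, centred P ψ F x ω) ^ (2 * k) ∂P ≤
      2 ^ (2 * k) * (k ^ (2 * k) * (𝔯 ^ d) ^ k) * (U.card : ℝ) ^ (2 * k - ζ) := by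
  have hn1 : (1 : ℝ) ≤ U.card := by exact_mod_cast hU.card_pos
  calc _ ≤ ((U.card : ℝ) ^ ε) ^ (2 * k) *
        (2 ^ (2 * k) * ((k : ℝ) ^ (2 * k) * ((𝔯 : ℝ) ^ d * U.card) ^ k)) :=
        mul_le_mul_of_nonneg_left (h.integral_sum_centred_pow_le hF hw hP U hk) (by positivity)
    _ = 2 ^ (2 * k) * (k ^ (2 * k) * (𝔯 ^ d) ^ k) *
        (((U.card : ℝ) ^ ε) ^ (2 * k) * (U.card : ℝ) ^ k) := by
        rw [mul_pow ((𝔯 : ℝ) ^ d)]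
        ring
    _ ≤ _ := mul_le_mul_of_nonneg_left (hE.rpow_mul_pow_le hn1) (by positivity)

theorem CondA4.rpow_mul_integral_le [IsProbabilityMeasure P]
    (hE : AdmissibleExponents d ζ γ δ ε k) (hk : k ≠ 0) (hF : IsMonotoneObservable d ψ F)
    (hw : ∀ e : Edge d, Measurable fun ω : Env d => weight ω e) (hP : Stationary P)
    (h : CondA4 P) (U : Finset (Fin d → ℤ)) (hU : U.Nonempty) :
    ((U.card : ℝ) ^ ε) ^ (2 * k) * ∫ ω, (∑ x ∈ U, centred P ψ F x ω) ^ (2 * k) ∂P ≤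
      2 ^ (2 * k) * ((2 * k).factorial * Real.exp 1 * (2 ^ d) ^ k)
        * (U.card : ℝ) ^ (2 * k - ζ) := by
  have hn1 : (1 : ℝ) ≤ U.card := by exact_mod_cast hU.card_pos
  calc _ ≤ ((U.card : ℝ) ^ ε) ^ (2 * k) *
        (2 ^ (2 * k) * ((2 * k).factorial * Real.exp 1 * (2 ^ d * U.card) ^ k)) :=
        mul_le_mul_of_nonneg_left (h.integral_sum_centred_pow_le hF hw hP U hk) (by positivity)
    _ = 2 ^ (2 * k) * ((2 * k).factorial * Real.exp 1 * (2 ^ d) ^ k) *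
        (((U.card : ℝ) ^ ε) ^ (2 * k) * (U.card : ℝ) ^ k) := by
        rw [mul_pow (2 ^ d : ℝ)]
        ring
    _ ≤ _ := mul_le_mul_of_nonneg_left (hE.rpow_mul_pow_le hn1) (by positivity)

theorem min_div_one_mem_Icc {p T a : ℝ} (hT : 0 < T) (ha : 0 ≤ a) :
    min (a ^ p / T) 1 ∈ Set.Icc (0 : ℝ) 1 :=
  ⟨le_min (div_nonneg (Real.rpow_nonneg ha _) hT.le) zero_le_one, min_le_right _ _⟩

theorem min_div_one_le {p T a b : ℝ} (hp : 1 ≤ p) (hT : 0 < T) (ha : 0 ≤ a) (hab : a ≤ b) :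
    min (a ^ p / T) 1 ≤ min (b ^ p / T) 1 :=
  min_le_min_right _
    (div_le_div_of_nonneg_right (Real.rpow_le_rpow ha hab (by linarith)) hT.le)

/-- Up to a sign, the truncated observable `min(A ^ p / T, 1)` is non-decreasing, and the sign is
irrelevant for even moments. -/
theorem exists_isMonotoneObservable_truncation (d : ℕ) {p T : ℝ} (hp : 1 ≤ p) (hT : 0 < T)
    (hψ : IsSmoothProfile ψ)
    (hmono : MonotoneOn ψ (Set.Ioi 0) ∨ AntitoneOn ψ (Set.Ioi 0)) :
    ∃ σ : ℝ, σ ^ 2 = 1 ∧ IsMonotoneObservable d ψ fun a => σ * min (a ^ p / T) 1 := by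
  have hA0 : ∀ (ω : Env d) x, 0 ≤ siteSum ψ ω x := fun ω x => siteSum_nonneg hψ.pos ω x
  have hI : ∀ (ω : Env d) x, min (siteSum ψ ω x ^ p / T) 1 ∈ Set.Icc (0 : ℝ) 1 := fun ω x =>
    min_div_one_mem_Icc hT (hA0 ω x)
  have hm : Measurable fun a : ℝ => min (a ^ p / T) 1 := by fun_prop
  rcases hmono with h | h
  · refine ⟨1, one_pow 2, hψ.measurable, hm.const_mul 1, fun x ω ω' hle => ?_, fun ω x => ?_,
      0, fun ω x => ?_⟩
    · simp only [one_mul]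
      exact min_div_one_le hp hT (hA0 _ _) (siteSum_le_of_monotoneOn h hle x)
    · rw [one_mul, abs_of_nonneg (hI ω x).1]
      exact (hI ω x).2
    · simpa using hI ω x
  · refine ⟨-1, by norm_num, hψ.measurable, hm.const_mul (-1), fun x ω ω' hle => ?_,
      fun ω x => ?_, -1, fun ω x => ?_⟩
    · simp only [neg_mul, one_mul]
      exact neg_le_neg (min_div_one_le hp hT (hA0 _ _) (siteSum_le_of_antitoneOn h hle x))
    · rw [neg_mul, one_mul, abs_neg, abs_of_nonneg (hI ω x).1]
      exact (hI ω x).2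
    · have := hI ω x
      constructor
      · linarith [this.2]
      · linarith [this.1]

end Assembly

section Core

variable {d : ℕ} [MeasurableSpace (Env d)] {P : Measure (Env d)} {ψ : ℝ → ℝ}
  {ζ γ δ ε p : ℝ}

/-- The constant of `integral_sum_pow_le_of_truncated_conditions`: the contributions of (A1), (A3)
and (A4), and of the removal of the truncation. -/
noncomputable def truncationConst (d k : ℕ) (Cmix : ℝ) (𝔯 : ℕ) (B : ℝ) : ℝ :=
  2 ^ (2 * k) * (2 ^ (2 * k) * (2 * k * |Cmix| + k ^ (2 * k) * (2 ^ d) ^ k)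
    + 2 ^ (2 * k) * (k ^ (2 * k) * (𝔯 ^ d) ^ k)
    + 2 ^ (2 * k) * ((2 * k).factorial * Real.exp 1 * (2 ^ d) ^ k) + 2 ^ (2 * k) * B)

theorem truncationConst_nonneg (d k : ℕ) (Cmix : ℝ) (𝔯 : ℕ) {B : ℝ} (hB : 0 ≤ B) :
    0 ≤ truncationConst d k Cmix 𝔯 B := by
  unfold truncationConst
  positivity

theorem integral_sum_pow_le_of_truncated_conditions [IsProbabilityMeasure P] (hd : d ≠ 0) {k : ℕ}
    (hE : AdmissibleExponents d ζ γ δ ε k) (hk : k ≠ 0) (hζ : 1 ≤ ζ) (hp : 1 ≤ p)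
    (hψ : IsSmoothProfile ψ) (hmono : MonotoneOn ψ (Set.Ioi 0) ∨ AntitoneOn ψ (Set.Ioi 0))
    (hw : ∀ e : Edge d, Measurable fun ω : Env d => weight ω e) (hP : Stationary P)
    {Cmix : ℝ} {𝔯 : ℕ} {B : ℝ}
    (hcond : (CondA1 P γ Cmix ∧ ζ < γ / d) ∨ CondA3 P 𝔯 ∨ CondA4 P)
    (hBi : Integrable (fun ω => (siteSum ψ ω 0 ^ p) ^ (2 * k + ζ / ε)) P)
    (hB : ∫ ω, (siteSum ψ ω 0 ^ p) ^ (2 * k + ζ / ε) ∂P ≤ B)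
    (U : Finset (Fin d → ℤ)) (hU : U.Nonempty) :
    ∫ ω, (∑ x ∈ U, (siteSum ψ ω x ^ p - ∫ ω', siteSum ψ ω' 0 ^ p ∂P)) ^ (2 * k) ∂P ≤
      truncationConst d k Cmix 𝔯 B * (U.card : ℝ) ^ (2 * k - ζ) := by
  have hA0 : ∀ (ω : Env d) x, 0 ≤ siteSum ψ ω x := fun ω x => siteSum_nonneg hψ.pos ω x
  have hX0 : ∀ (x : Fin d → ℤ) (ω : Env d), 0 ≤ siteSum ψ ω x ^ p := fun x ω =>
    Real.rpow_nonneg (hA0 ω x) p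
  have hn1 : (1 : ℝ) ≤ U.card := by exact_mod_cast hU.card_pos
  have hn0 : (0 : ℝ) < U.card := by linarith
  set T : ℝ := (U.card : ℝ) ^ ε with hT
  have hT0 : 0 < T := Real.rpow_pos_of_pos hn0 ε
  have hm0 : 0 < ζ / ε := div_pos (by linarith) hE.eps_pos
  have hB0 : 0 ≤ B := le_trans (integral_nonneg fun ω => Real.rpow_nonneg (hX0 0 ω) _) hB
  obtain ⟨σ, hσ, hF⟩ := exists_isMonotoneObservable_truncation d hp hT0 hψ hmono
  have htr := integral_sum_pow_le_of_truncation (P := P) U (fun x ω => siteSum ψ ω x ^ p)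
    (fun x => (measurable_siteSum hw hψ.measurable x).pow_const p) hX0 hk hm0 hT0
    (hP.integrable_siteSum (F := fun a => (a ^ p) ^ (2 * k + ζ / ε)) hBi)
    (fun x => (hP.integral_siteSum hw hψ.measurable
      (F := fun a => (a ^ p) ^ (2 * k + ζ / ε)) (by fun_prop) x).trans_le hB) hB0
    (hP.integral_siteSum hw hψ.measurable (F := fun a => a ^ p) (by fun_prop))
  refine htr.trans ?_
  set Z : Env d → ℝ := fun ω => ∑ x ∈ U,
    centred P ψ (fun a => σ * min (a ^ p / T) 1) x ω with hZ
  have hsign : ∀ ω, (∑ x ∈ U, (min (siteSum ψ ω x ^ p / T) 1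
      - ∫ ω', min (siteSum ψ ω' x ^ p / T) 1 ∂P)) ^ (2 * k) = Z ω ^ (2 * k) := fun ω => by
    have h1 : Z ω = σ * ∑ x ∈ U, (min (siteSum ψ ω x ^ p / T) 1
        - ∫ ω', min (siteSum ψ ω' x ^ p / T) 1 ∂P) := by
      simp only [hZ, centred]
      rw [Finset.mul_sum]
      refine Finset.sum_congr rfl fun x _ => ?_
      rw [integral_const_mul, ← mul_sub, hP.integral_siteSum hw hψ.measurable
        (F := fun a => min (a ^ p / T) 1) (by fun_prop) x]
    rw [h1, mul_pow, pow_mul σ, hσ, one_pow, one_mul]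
  simp_rw [hsign]
  -- the extra moment `ζ / ε` is what turns the truncation level `n ^ ε` into a gain `n ^ ζ`
  have hTm : T ^ (-(ζ / ε)) = (U.card : ℝ) ^ (-ζ) := by
    rw [hT, ← Real.rpow_mul hn0.le]
    congr 1
    have := hE.eps_pos.ne'
    field_simp
  have hU2 : (U.card : ℝ) ^ (2 * k) * (U.card : ℝ) ^ (-ζ) = (U.card : ℝ) ^ (2 * k - ζ) := by
    rw [← Real.rpow_natCast, ← Real.rpow_add hn0]
    congr 1
    push_cast
    ring
  set N := (U.card : ℝ) ^ (2 * k - ζ) with hN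
  have hN0 : 0 ≤ N := Real.rpow_nonneg hn0.le _
  have hK1 : 0 ≤ 2 ^ (2 * k) * (2 * k * |Cmix| + (k : ℝ) ^ (2 * k) * (2 ^ d) ^ k) * N := by
    positivity
  have hK3 : 0 ≤ 2 ^ (2 * k) * ((k : ℝ) ^ (2 * k) * ((𝔯 : ℝ) ^ d) ^ k) * N := by positivity
  have hK4 : 0 ≤ 2 ^ (2 * k) * ((2 * k).factorial * Real.exp 1 * (2 ^ d) ^ k) * N := by positivity
  have hsum : T ^ (2 * k) * ∫ ω, Z ω ^ (2 * k) ∂P ≤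
      2 ^ (2 * k) * (2 * k * |Cmix| + (k : ℝ) ^ (2 * k) * (2 ^ d) ^ k) * N
      + 2 ^ (2 * k) * ((k : ℝ) ^ (2 * k) * ((𝔯 : ℝ) ^ d) ^ k) * N
      + 2 ^ (2 * k) * ((2 * k).factorial * Real.exp 1 * (2 ^ d) ^ k) * N := by
    rcases hcond with ⟨h, hγ⟩ | h | h
    · have := h.rpow_mul_integral_le hd hE hk hγ hF hw hP U hU
      rw [abs_of_pos h.2.1] at hK1 ⊢
      linarith
    · have := h.rpow_mul_integral_le hE hk hF hw hP U hU
      linarith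
    · have := h.rpow_mul_integral_le hE hk hF hw hP U hU
      linarith
  calc _ ≤ 2 ^ (2 * k) * (2 ^ (2 * k) * (2 * k * |Cmix| + (k : ℝ) ^ (2 * k) * (2 ^ d) ^ k) * N
      + 2 ^ (2 * k) * ((k : ℝ) ^ (2 * k) * ((𝔯 : ℝ) ^ d) ^ k) * N
      + 2 ^ (2 * k) * ((2 * k).factorial * Real.exp 1 * (2 ^ d) ^ k) * N
      + 2 ^ (2 * k) * B * N) := by
        refine mul_le_mul_of_nonneg_left (add_le_add hsum (le_of_eq ?_)) (by positivity)
        rw [hTm, ← hU2]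
        ring
    _ = _ := by
        rw [truncationConst]
        ring

theorem gradBound_pow_le (d : ℕ) (hp : 1 ≤ p) {k : ℕ} {p₀ : ℝ} (hk : (p + 1) * (2 * k) ≤ p₀)
    {A : ℝ} (hA : 0 ≤ A) :
    gradBound d p A ^ (2 * k) ≤ (2 * p * 3 ^ d) ^ (2 * k) * (2 ^ p₀ * (1 + A ^ p₀)) := by
  have hp₀ : 0 ≤ p₀ := le_trans (by positivity) hk
  rw [gradBound, mul_pow]
  refine mul_le_mul_of_nonneg_left ?_ (by positivity)
  rw [← Real.rpow_natCast, ← Real.rpow_mul (by linarith)]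
  have h1 : (1 + A) ^ ((p + 1) * ((2 * k : ℕ) : ℝ)) ≤ (1 + A) ^ p₀ :=
    Real.rpow_le_rpow_of_exponent_le (by linarith) (by push_cast; exact hk)
  refine h1.trans ?_
  rcases le_total A 1 with h | h
  · calc (1 + A) ^ p₀ ≤ 2 ^ p₀ := Real.rpow_le_rpow (by linarith) (by linarith) hp₀
      _ ≤ _ := le_mul_of_one_le_right (by positivity)
          (by linarith [Real.rpow_nonneg hA p₀])
  · calc (1 + A) ^ p₀ ≤ (2 * A) ^ p₀ := Real.rpow_le_rpow (by linarith) (by linarith) hp₀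
      _ = 2 ^ p₀ * A ^ p₀ := Real.mul_rpow (by norm_num) hA
      _ ≤ _ := mul_le_mul_of_nonneg_left (by linarith) (by positivity)

theorem rpow_le_one_add_rpow {A s t : ℝ} (hA : 0 ≤ A) (hs : 0 ≤ s) (hst : s ≤ t) :
    A ^ s ≤ 1 + A ^ t := by
  rcases le_total A 1 with h | h
  · linarith [Real.rpow_le_one hA h hs, Real.rpow_nonneg hA t]
  · linarith [Real.rpow_le_rpow_of_exponent_le h hst]

/-- The constant of `integral_sum_rpow_sub_mean_pow_le`: the constants for the truncated sums and
for the spectral gap are added, so that one value serves all four conditions. -/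
noncomputable def momentConst (d J : ℕ) (p p₀ Cmix Csg : ℝ) (𝔯 : ℕ) (M : ℝ) : ℝ :=
  truncationConst d (2 ^ J) Cmix 𝔯 (1 + |M|)
    + gapConst (4 * |Csg| * 3 ^ d) ((2 * p * 3 ^ d) ^ (2 * 2 ^ J) * (2 ^ p₀ * (1 + |M|))) J

theorem momentConst_nonneg (d J : ℕ) (hp : 1 ≤ p) (p₀ Cmix Csg : ℝ) (𝔯 : ℕ) (M : ℝ) :
    0 ≤ momentConst d J p p₀ Cmix Csg 𝔯 M :=
  add_nonneg (truncationConst_nonneg _ _ _ _ (by positivity))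
    (gapConst_nonneg (by positivity) (by positivity) _)

/-- The moment bound for the sums of `(∑_{y ∼ x} ψ(ω(x,y))) ^ p` over arbitrary finite sets, for
`ψ(w) = w` and `ψ(w) = 1 / w` alike. -/
theorem integral_sum_rpow_sub_mean_pow_le [IsProbabilityMeasure P] (hd : d ≠ 0) {J : ℕ}
    (hE : AdmissibleExponents d ζ γ δ ε (2 ^ J)) (hζ : 1 ≤ ζ) (hp : 1 ≤ p)
    (hψ : IsSmoothProfile ψ) (hmono : MonotoneOn ψ (Set.Ioi 0) ∨ AntitoneOn ψ (Set.Ioi 0))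
    (hw : ∀ e : Edge d, Measurable fun ω : Env d => weight ω e) (hP : Stationary P)
    {Cmix Csg : ℝ} {𝔯 : ℕ} {M p₀ : ℝ} (hp₀ : p₀ = (p + 1) * (2 * 2 ^ J + ζ / ε))
    (hcond : (CondA1 P γ Cmix ∧ ζ < γ / d) ∨ CondA2 P Csg ∨ CondA3 P 𝔯 ∨ CondA4 P)
    (hi : Integrable (fun ω => siteSum ψ ω 0 ^ p₀) P) (hM : ∫ ω, siteSum ψ ω 0 ^ p₀ ∂P ≤ M) :
    Integrable (fun ω => siteSum ψ ω 0 ^ p) P ∧ ∀ U : Finset (Fin d → ℤ),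
      Integrable (fun ω => (∑ x ∈ U, (siteSum ψ ω x ^ p - ∫ ω', siteSum ψ ω' 0 ^ p ∂P))
        ^ (2 * 2 ^ J)) P ∧
      ∫ ω, (∑ x ∈ U, (siteSum ψ ω x ^ p - ∫ ω', siteSum ψ ω' 0 ^ p ∂P)) ^ (2 * 2 ^ J) ∂P ≤
        momentConst d J p p₀ Cmix Csg 𝔯 M * (U.card : ℝ) ^ (2 * 2 ^ J - ζ) := by
  have hA0 : ∀ (ω : Env d) x, 0 ≤ siteSum ψ ω x := fun ω x => siteSum_nonneg hψ.pos ω x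
  have hAm := measurable_siteSum hw hψ.measurable
  have hk : (2 ^ J : ℕ) ≠ 0 := by positivity
  have hm0 : 0 < ζ / ε := div_pos (by linarith) hE.eps_pos
  have h2J : (1 : ℝ) ≤ 2 ^ J := one_le_pow₀ (by norm_num)
  have hexp1 : p ≤ p₀ := by rw [hp₀]; nlinarith
  have hexp2 : p * (2 * ((2 ^ J : ℕ) : ℝ) + ζ / ε) ≤ p₀ := by
    rw [hp₀]; push_cast; nlinarith
  have hexp3 : (p + 1) * (2 * ((2 ^ J : ℕ) : ℝ)) ≤ p₀ := by
    rw [hp₀]; push_cast; nlinarith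
  have hM0 : 0 ≤ M := le_trans (integral_nonneg fun ω => Real.rpow_nonneg (hA0 ω 0) _) hM
  have h1i : Integrable (fun ω => 1 + siteSum ψ ω 0 ^ p₀) P := (integrable_const 1).add hi
  have h1M : ∫ ω, (1 + siteSum ψ ω 0 ^ p₀) ∂P ≤ 1 + |M| := by
    rw [integral_add (integrable_const 1) hi, abs_of_nonneg hM0]
    simpa using hM
  have hpi : Integrable (fun ω => siteSum ψ ω 0 ^ p) P :=
    h1i.mono' ((hAm 0).pow_const p).aestronglyMeasurable (ae_of_all _ fun ω => by
      rw [Real.norm_eq_abs, abs_of_nonneg (Real.rpow_nonneg (hA0 ω 0) _)]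
      exact rpow_le_one_add_rpow (hA0 ω 0) (by linarith) hexp1)
  have hBle : ∀ ω : Env d, (siteSum ψ ω 0 ^ p) ^ (2 * ((2 ^ J : ℕ) : ℝ) + ζ / ε)
      ≤ 1 + siteSum ψ ω 0 ^ p₀ := fun ω => by
    rw [← Real.rpow_mul (hA0 ω 0)]
    exact rpow_le_one_add_rpow (hA0 ω 0) (by positivity) hexp2
  have hBi : Integrable (fun ω => (siteSum ψ ω 0 ^ p) ^ (2 * ((2 ^ J : ℕ) : ℝ) + ζ / ε)) P :=
    h1i.mono' (((hAm 0).pow_const p).pow_const _).aestronglyMeasurable (ae_of_all _ fun ω => by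
      rw [Real.norm_eq_abs, abs_of_nonneg (Real.rpow_nonneg (Real.rpow_nonneg (hA0 ω 0) _) _)]
      exact hBle ω)
  have hB : ∫ ω, (siteSum ψ ω 0 ^ p) ^ (2 * ((2 ^ J : ℕ) : ℝ) + ζ / ε) ∂P ≤ 1 + |M| :=
    (integral_mono hBi h1i hBle).trans h1M
  set K : ℝ := (2 * p * 3 ^ d) ^ (2 * 2 ^ J) with hK
  have hGle : ∀ ω : Env d, gradBound d p (siteSum ψ ω 0) ^ (2 * 2 ^ J)
      ≤ K * (2 ^ p₀ * (1 + siteSum ψ ω 0 ^ p₀)) := fun ω =>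
    gradBound_pow_le d hp hexp3 (hA0 ω 0)
  have hGdom : Integrable (fun ω => K * (2 ^ p₀ * (1 + siteSum ψ ω 0 ^ p₀))) P :=
    (h1i.const_mul _).const_mul _
  have hGi0 : Integrable (fun ω => gradBound d p (siteSum ψ ω 0) ^ (2 * 2 ^ J)) P :=
    hGdom.mono' (((measurable_gradBound d p).comp (hAm 0)).pow_const _).aestronglyMeasurable
      (ae_of_all _ fun ω => by
        rw [Real.norm_eq_abs, abs_of_nonneg ((even_two_mul _).pow_nonneg _)]
        exact hGle ω)
  have hGi := hP.integrable_siteSum (F := fun a => gradBound d p a ^ (2 * 2 ^ J)) hGi0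
  have hGβ : ∀ x, ∫ ω, gradBound d p (siteSum ψ ω x) ^ (2 * 2 ^ J) ∂P
      ≤ K * (2 ^ p₀ * (1 + |M|)) := fun x => by
    rw [hP.integral_siteSum hw hψ.measurable (F := fun a => gradBound d p a ^ (2 * 2 ^ J))
      ((measurable_gradBound d p).pow_const _) x]
    refine (integral_mono hGi0 hGdom hGle).trans ?_
    rw [integral_const_mul, integral_const_mul]
    have hK0 : 0 ≤ K := by positivity
    gcongr
  have hmean := hP.integral_siteSum hw hψ.measurable (F := fun a => a ^ p) (by fun_prop)
  refine ⟨hpi, fun U => ⟨?_, ?_⟩⟩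
  · refine integrable_pow_of_memLp hk (memLp_finsetSum U fun x _ => ?_)
    have hXm : Measurable fun ω : Env d => siteSum ψ ω x ^ p := (hAm x).pow_const p
    refine MemLp.sub (memLp_of_integrable_pow hk hXm.aestronglyMeasurable ?_) (memLp_const _)
    refine (hGi x).mono' (hXm.pow_const _).aestronglyMeasurable (ae_of_all _ fun ω => ?_)
    have h0 : 0 ≤ siteSum ψ ω x ^ p := Real.rpow_nonneg (hA0 ω x) _
    rw [Real.norm_eq_abs, abs_of_nonneg (pow_nonneg h0 _)]
    exact pow_le_pow_left₀ h0 (rpow_le_gradBound d hp (hA0 ω x)) _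
  rcases U.eq_empty_or_nonempty with rfl | hU
  · have := momentConst_nonneg d J hp p₀ Cmix Csg 𝔯 M
    simp only [Finset.sum_empty, Finset.card_empty, Nat.cast_zero]
    rw [zero_pow (by positivity), integral_zero]
    positivity
  have hn1 : (1 : ℝ) ≤ U.card := by exact_mod_cast hU.card_pos
  have hcast : (2 * ((2 ^ J : ℕ) : ℝ) - ζ) = 2 * 2 ^ J - ζ := by push_cast; ring
  have hN0 : 0 ≤ (U.card : ℝ) ^ (2 * 2 ^ J - ζ) := by positivity
  have hT0 := truncationConst_nonneg d (2 ^ J) Cmix 𝔯 (B := 1 + |M|) (by positivity)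
  have hG0 := gapConst_nonneg (D := 4 * |Csg| * 3 ^ d) (β := K * (2 ^ p₀ * (1 + |M|)))
    (by positivity) (by positivity) J
  have htrunc : ((CondA1 P γ Cmix ∧ ζ < γ / d) ∨ CondA3 P 𝔯 ∨ CondA4 P) →
      ∫ ω, (∑ x ∈ U, (siteSum ψ ω x ^ p - ∫ ω', siteSum ψ ω' 0 ^ p ∂P)) ^ (2 * 2 ^ J) ∂P ≤
        momentConst d J p p₀ Cmix Csg 𝔯 M * (U.card : ℝ) ^ (2 * 2 ^ J - ζ) := fun hc => by
    have := integral_sum_pow_le_of_truncated_conditions hd hE hk hζ hp hψ hmono hw hP hc hBi hB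
      U hU
    rw [hcast] at this
    refine this.trans (mul_le_mul_of_nonneg_right ?_ hN0)
    exact le_add_of_nonneg_right hG0
  rcases hcond with h | h | h | h
  · exact htrunc (Or.inl h)
  · have := h.integral_sum_pow_le hψ hp hw hmean (hP.integrable_siteSum (F := fun a => a ^ p) hpi)
      U hGi hGβ J le_rfl
    rw [← abs_of_pos h.1] at this
    refine this.trans (mul_le_mul (le_add_of_nonneg_left hT0) ?_ (by positivity)
      (add_nonneg hT0 hG0))
    rw [← Real.rpow_natCast]
    refine Real.rpow_le_rpow_of_exponent_le hn1 ?_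
    have := hE.le_natCast
    push_cast at this ⊢
    linarith
  · exact htrunc (Or.inr (Or.inl h))
  · exact htrunc (Or.inr (Or.inr h))

theorem integrable_siteSum_rpow {r : ℝ} (hr : 1 ≤ r) (hψ : IsSmoothProfile ψ)
    (h : ∀ e : Edge d, MemLp (fun ω => ψ (weight ω e)) (ENNReal.ofReal r) P) :
    Integrable (fun ω => siteSum ψ ω 0 ^ r) P := by
  have h1 : MemLp (fun ω => siteSum ψ ω 0) (ENNReal.ofReal r) P := by
    refine memLp_finsetSum _ fun y hy => ?_
    simp only [cond_eq_weight _ ((mem_nbrs 0 y).1 hy)]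
    exact h _
  have h2 := h1.integrable_norm_rpow (by simpa using by linarith) ENNReal.ofReal_ne_top
  rw [ENNReal.toReal_ofReal (by linarith)] at h2
  refine h2.congr (ae_of_all _ fun ω => ?_)
  change ‖siteSum ψ ω 0‖ ^ r = siteSum ψ ω 0 ^ r
  rw [Real.norm_eq_abs, abs_of_nonneg (siteSum_nonneg hψ.pos ω 0)]

theorem lintegral_abs_rpow_le {S : Env d → ℝ} {k : ℕ} {η c N : ℝ} (hη : η = (2 * k : ℕ))
    (hi : Integrable (fun ω => S ω ^ (2 * k)) P) (h : ∫ ω, S ω ^ (2 * k) ∂P ≤ c * N) :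
    ∫⁻ ω, ENNReal.ofReal (|S ω| ^ η) ∂P ≤ ENNReal.ofReal (c * N) := by
  have h1 : ∀ ω, |S ω| ^ η = S ω ^ (2 * k) := fun ω => by
    rw [hη, Real.rpow_natCast, (even_two_mul k).pow_abs]
  simp_rw [h1]
  rw [← ofReal_integral_eq_lintegral_ofReal hi
    (ae_of_all _ fun ω => (even_two_mul k).pow_nonneg _)]
  exact ENNReal.ofReal_le_ofReal h

end Core

theorem isSmoothProfile_id : IsSmoothProfile fun w : ℝ => w where
  measurable := measurable_id
  pos _ hw := hw
  contDiffOn := contDiffOn_id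
  abs_deriv_le w _ := by
    rw [deriv_id'', abs_one]
    nlinarith [sq_nonneg w]

theorem isSmoothProfile_one_div : IsSmoothProfile fun w : ℝ => 1 / w where
  measurable := by fun_prop
  pos _ hw := one_div_pos.2 hw
  contDiffOn := contDiffOn_const.div contDiffOn_id fun w hw => ne_of_gt hw
  abs_deriv_le w hw := by
    simp only [one_div]
    rw [deriv_inv, abs_neg, abs_of_nonneg (by positivity), inv_pow]
    linarith

end RCM

theorem mainTheorem3 (d : ℕ) (hd : 2 ≤ d) (ζ p q γ : ℝ)
    (hζ : 1 ≤ ζ) (hp : 1 ≤ p) (hq : 1 ≤ q) :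
    ∃ p₀ q₀ η θ : ℝ, 1 ≤ p₀ ∧ 1 ≤ q₀ ∧ 1 ≤ η ∧ 1 ≤ θ ∧ ζ ≤ η - θ ∧
      ∀ (Cmix Csg : ℝ) (𝔯 : ℕ) (M : ℝ), ∃ c : ℝ, 0 < c ∧
        ∀ [MeasurableSpace (RCM.Env d)] (P : Measure (RCM.Env d)) [IsProbabilityMeasure P],
          (∀ e : RCM.Edge d, Measurable fun ω : RCM.Env d => RCM.weight ω e) →
          RCM.Stationary P →
          ((RCM.CondA1 P γ Cmix ∧ ζ < γ / d) ∨ RCM.CondA2 P Csg ∨ RCM.CondA3 P 𝔯 ∨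
            RCM.CondA4 P) →
          (∀ e : RCM.Edge d, MemLp (fun ω => RCM.weight ω e) (ENNReal.ofReal p₀) P) →
          (∀ e : RCM.Edge d, MemLp (fun ω => (RCM.weight ω e)⁻¹) (ENNReal.ofReal q₀) P) →
          ∫ ω, RCM.muW ω 0 ^ p₀ ∂P ≤ M →
          ∫ ω, RCM.nuW ω 0 ^ q₀ ∂P ≤ M →
          RCM.MomentBound P p q η θ c := by
  obtain ⟨δ, ε, J, hE⟩ := RCM.exists_admissibleExponents d γ hζ
  have hm0 : 0 < ζ / ε := div_pos (by linarith) hE.eps_pos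
  have h2J : (1 : ℝ) ≤ 2 ^ J := one_le_pow₀ (by norm_num)
  have hζk := hE.le_natCast
  push_cast at hζk
  have hp₀ : 1 ≤ (p + 1) * (2 * 2 ^ J + ζ / ε) := by nlinarith
  have hq₀ : 1 ≤ (q + 1) * (2 * 2 ^ J + ζ / ε) := by nlinarith
  refine ⟨(p + 1) * (2 * 2 ^ J + ζ / ε), (q + 1) * (2 * 2 ^ J + ζ / ε), 2 * 2 ^ J,
    2 * 2 ^ J - ζ, hp₀, hq₀, by linarith, by linarith, by linarith, fun Cmix Csg 𝔯 M => ?_⟩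
  have hc1 := RCM.momentConst_nonneg d J hp ((p + 1) * (2 * 2 ^ J + ζ / ε)) Cmix Csg 𝔯 M
  have hc2 := RCM.momentConst_nonneg d J hq ((q + 1) * (2 * 2 ^ J + ζ / ε)) Cmix Csg 𝔯 M
  set c₁ := RCM.momentConst d J p ((p + 1) * (2 * 2 ^ J + ζ / ε)) Cmix Csg 𝔯 M
  set c₂ := RCM.momentConst d J q ((q + 1) * (2 * 2 ^ J + ζ / ε)) Cmix Csg 𝔯 M
  refine ⟨c₁ + c₂ + 1, by linarith, fun P _ hw hP hcond hLp hLq hMp hMq => ?_⟩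
  have hmu := RCM.integral_sum_rpow_sub_mean_pow_le (by omega) hE hζ hp RCM.isSmoothProfile_id
    (Or.inl fun a _ b _ h => h) hw hP rfl hcond
    (RCM.integrable_siteSum_rpow hp₀ RCM.isSmoothProfile_id hLp) hMp
  have hnu := RCM.integral_sum_rpow_sub_mean_pow_le (by omega) hE hζ hq
    RCM.isSmoothProfile_one_div (Or.inr fun a ha b _ h => one_div_le_one_div_of_le ha h) hw hP rfl
    hcond (RCM.integrable_siteSum_rpow hq₀ RCM.isSmoothProfile_one_div
      (by simpa only [one_div] using hLq)) hMq
  refine ⟨hmu.1, hnu.1, fun a b => ⟨?_, ?_⟩⟩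
  · refine RCM.lintegral_abs_rpow_le (k := 2 ^ J) (by push_cast; ring)
      (hmu.2 (Finset.Icc a b)).1 ((hmu.2 (Finset.Icc a b)).2.trans ?_)
    exact mul_le_mul_of_nonneg_right (by linarith) (by positivity)
  · refine RCM.lintegral_abs_rpow_le (k := 2 ^ J) (by push_cast; ring)
      (hnu.2 (Finset.Icc a b)).1 ((hnu.2 (Finset.Icc a b)).2.trans ?_)
    exact mul_le_mul_of_nonneg_right (by linarith) (by positivity)
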